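/- For $n\ge 0$ let $Y(n)$ be the category whose objects are the complete parenthesizations of a nonempty finite list in which each of the variables $1,\dots,n$ fills exactly one slot (in any order) and every other slot is filled with the symbol $e$, and which has exactly one morphism from any object to any other. Thus all diagrams in $Y(n)$ commute. The $Y(n)$ form a symmetric operad in categories: $p\cdot\sigma$ is $p$ with each variable $i$ replaced by $\sigma^{-1}(i)$ ($\sigma\in\Sigma_n$); $\gamma(p;p_1,\dots,p_n)$ is obtained by substituting $p_1,\dots,p_n$, with their variables renumbered consecutively, for the variables of $p$; the identity $1\in Y(1)$ is the single variable. Let $(\mathcal C,\oplus,e)$ be a symmetric monoidal category. An object $p\in Y(n)$ defines a functor $p:\mathcal C^n\to\mathcal C$ by evaluating the parenthesized word with $\oplus$ and the unit object $e$. An *action of $Y$ on $\mathcal C$* is a family of functors $Y(n)\to\mathbf{Cat}(\mathcal C^n,\mathcal C)$ given in this way on objects, compatible with the $\Sigma_n$-actions and with $\gamma$, which sends the unique morphisms $(x_1x_2)x_3\to x_1(x_2x_3)$, $e\,x_1\to x_1$, $x_1e\to x_1$ and $x_1x_2\to x_2x_1$ to the associativity, left unit, right unit and commutativity isomorphisms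 of $\mathcal C$. **Theorem.** $\mathcal C$ admits an action of $Y$. Moreover, for any such action and any sequence of functions $\kappa_n:\mathrm{Ob}\,\mathcal C^n\to\mathrm{Ob}\,Y(n)$, $n\ge0$, write $\overline\kappa\mathbf x=\kappa_n(\mathbf x)(\mathbf x)$ and $U_\kappa\mathcal C(\mathbf x;y)=\mathcal C(\overline\kappa\mathbf x,y)$ for $\mathbf x\in\mathrm{Ob}\,\mathcal C^n$, $y\in\mathrm{Ob}\,\mathcal C$ (an element being regarded as carrying its source tuple $\mathbf x$). Then these sets form a symmetric multicategory with objects the objects of $\mathcal C$ and with the following structure. 1. The identity of $a$ in $U_\kappa\mathcal C(a;a)$ is the map $\overline\kappa(a)\to a$ given by the unique isomorphism $\kappa_1(a)\to1$ in $Y(1)$. 2. For $\sigma\in\Sigma_n$ and $\sigma^{-1}\mathbf x=(x_{\sigma(1)},\dots,x_{\sigma(n)})$, the map $\sigma^*:U_\kappa\mathcal C(\mathbf x;y)\to U_\kappa\mathcal C(\sigma^{-1}\mathbf x;y)$ is precomposition with the map $\overline\kappa(\sigma^{-1}\mathbf x)\to(\kappa_n(\mathbf x)\cdot\sigma)(\sigma^{-1}\mathbf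 x)=\overline\kappa\mathbf x$ given by the unique isomorphism $\kappa_n(\sigma^{-1}\mathbf x)\to\kappa_n(\mathbf x)\cdot\sigma$ in $Y(n)$. 3. For $\mathbf y=(y_1,\dots,y_n)$, tuples $\mathbf x_s$ of length $j_s$ with concatenation $\odot_s\mathbf x_s$ of length $j=j_1+\dots+j_n$, $f\in U_\kappa\mathcal C(\mathbf y;z)$ and $g_s\in U_\kappa\mathcal C(\mathbf x_s;y_s)$, the composite $\Gamma(f;g_1,\dots,g_n)\in U_\kappa\mathcal C(\odot_s\mathbf x_s;z)$ is $$\overline\kappa(\odot_s\mathbf x_s)\longrightarrow\kappa_n(\mathbf y)(\overline\kappa\mathbf x_1,\dots,\overline\kappa\mathbf x_n)\xrightarrow{\kappa_n(\mathbf y)(g_1,\dots,g_n)}\overline\kappa\mathbf y\xrightarrow{\ f\ }z,$$ where the first map is given by the unique isomorphism $\kappa_j(\odot_s\mathbf x_s)\to\gamma(\kappa_n(\mathbf y);\kappa_{j_1}(\mathbf x_1),\dots,\kappa_{j_n}(\mathbf x_n))$ in $Y(j)$. That is: the maps $\sigma^*$ form a right action, $\tau^*\sigma^*=(\sigma\tau)^*$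 and $1^*=\mathrm{id}$; $\Gamma$ is associative; $\Gamma(f;\mathrm{id}_{c_1},\dots,\mathrm{id}_{c_n})=f$ for $f\in U_\kappa\mathcal C(c_1,\dots,c_n;d)$, and $\Gamma(\mathrm{id}_d;f)=f$; and $\Gamma$ is equivariant, $\Gamma(\sigma^*f;g_{\sigma(1)},\dots,g_{\sigma(n)})=\sigma\langle j_{\sigma(1)},\dots,j_{\sigma(n)}\rangle^*\,\Gamma(f;g_1,\dots,g_n)$ for the block permutation $\sigma\langle j_{\sigma(1)},\dots,j_{\sigma(n)}\rangle$, and $\Gamma(f;\tau_1^*g_1,\dots,\tau_n^*g_n)=(\tau_1\oplus\dots\oplus\tau_n)^*\,\Gamma(f;g_1,\dots,g_n)$ for $\tau_s\in\Sigma_{j_s}$. -/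

import Mathlib

open CategoryTheory MonoidalCategory

namespace SMCMulti

universe v u w

/-! ## Tuples

An `n`-tuple is a function `x : Fin n → α`; for a permutation `σ` the tuple
`σ⁻¹x = (x_{σ(1)}, …, x_{σ(n)})` is `x ∘ σ`. -/

/-- The concatenation `⊙ₛ xₛ` of a tuple of tuples. The bijection `finSigmaFinEquiv` from the
pairs `(s, t)` to the positions in the concatenation is the lexicographic one. -/
def concat {α : Type u} {n : ℕ} {j : Fin n → ℕ} (xs : ∀ s, Fin (j s) → α) :
    Fin (∑ s, j s) → α :=
  fun k => xs (finSigmaFinEquiv.symm k).1 (finSigmaFinEquiv.symm k).2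

/-- The block permutation `σ⟨j_{σ(1)}, …, j_{σ(n)}⟩`: it sends the `t`-th position of the `s`-th
block, in the arrangement with block lengths `j_{σ(1)}, …, j_{σ(n)}`, to the `t`-th position of the
`σ(s)`-th block, in the arrangement with block lengths `j₁, …, jₙ`. -/
def blockPerm {n : ℕ} (j : Fin n → ℕ) (σ : Equiv.Perm (Fin n)) :
    Equiv.Perm (Fin (∑ s, j s)) :=
  (finCongr (Equiv.sum_comp σ j).symm).trans
    (finSigmaFinEquiv.symm.trans
      ((Equiv.sigmaCongrLeft (β := fun s => Fin (j s)) σ).trans finSigmaFinEquiv))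

/-- The block sum `τ₁ ⊕ ⋯ ⊕ τₙ` of permutations. -/
def sumPerm {n : ℕ} {j : Fin n → ℕ} (τ : ∀ s, Equiv.Perm (Fin (j s))) :
    Equiv.Perm (Fin (∑ s, j s)) :=
  finSigmaFinEquiv.symm.trans ((Equiv.sigmaCongrRight τ).trans finSigmaFinEquiv)

/-! ## Symmetric multicategories -/

/-- The data of a symmetric multicategory with objects `Ob`: sets of `n`-morphisms `(x₁,…,xₙ) ⟶ y`
for `n ≥ 0`, identities, the maps `σ^*` and the composition multiproduct `Γ`. -/
structure MulticategoryData (Ob : Type u) where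
  Hom : ∀ {n : ℕ}, (Fin n → Ob) → Ob → Type v
  one : ∀ a : Ob, Hom (fun _ : Fin 1 => a) a
  perm : ∀ {n : ℕ} {x : Fin n → Ob} {y : Ob} (σ : Equiv.Perm (Fin n)), Hom x y → Hom (x ∘ σ) y
  comp : ∀ {n : ℕ} {y : Fin n → Ob} {z : Ob} {j : Fin n → ℕ} {xs : ∀ s, Fin (j s) → Ob},
    Hom y z → (∀ s, Hom (xs s) (y s)) → Hom (concat xs) z

namespace MulticategoryData

variable {Ob : Type u} (M : MulticategoryData.{v} Ob)

/-- Morphisms with target `y`, together with their source tuple. In the laws below the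
source tuples of the two sides are equal, but not by definition; an equality in `M.Mor y` says that
the source tuples agree and that the morphisms agree. -/
abbrev Mor (y : Ob) : Type (max u v) := Σ n : ℕ, Σ x : Fin n → Ob, M.Hom x y

variable {M} in
/-- A morphism bundled with its source tuple. -/
abbrev mor {n : ℕ} {x : Fin n → Ob} {y : Ob} (f : M.Hom x y) : M.Mor y := ⟨n, x, f⟩

/-- The laws of a symmetric multicategory. -/
structure IsSymmMulticategory : Prop where
  /-- The identity permutation acts as the identity. -/
  perm_one : ∀ {n : ℕ} {x : Fin n → Ob} {y : Ob} (f : M.Hom x y), mor (M.perm 1 f) = mor f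
  /-- Right action: `τ^* ∘ σ^* = (σ ∘ τ)^*`. -/
  perm_mul : ∀ {n : ℕ} {x : Fin n → Ob} {y : Ob} (σ τ : Equiv.Perm (Fin n)) (f : M.Hom x y),
    mor (M.perm τ (M.perm σ f)) = mor (M.perm (σ * τ) f)
  /-- Associativity of the multiproduct. -/
  assoc : ∀ {n : ℕ} {c : Fin n → Ob} {d : Ob} {j : Fin n → ℕ} {b : ∀ s, Fin (j s) → Ob}
    {l : ∀ s, Fin (j s) → ℕ} {a : ∀ s t, Fin (l s t) → Ob}
    (f : M.Hom c d) (g : ∀ s, M.Hom (b s) (c s)) (h : ∀ s t, M.Hom (a s t) (b s t)),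
    mor (M.comp f (fun s => M.comp (g s) (h s))) =
      mor (M.comp (y := concat b)
        (xs := fun k => a (finSigmaFinEquiv.symm k).1 (finSigmaFinEquiv.symm k).2)
        (M.comp f g) (fun k => h (finSigmaFinEquiv.symm k).1 (finSigmaFinEquiv.symm k).2))
  /-- Composing with identities on the inputs. -/
  comp_one : ∀ {n : ℕ} {c : Fin n → Ob} {d : Ob} (f : M.Hom c d),
    mor (M.comp f (fun s => M.one (c s))) = mor f
  /-- Composing with an identity on the output. -/
  one_comp : ∀ {n : ℕ} {c : Fin n → Ob} {d : Ob} (f : M.Hom c d),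
    mor (M.comp (xs := fun _ => c) (M.one d) (fun _ => f)) = mor f
  /-- Equivariance with respect to a permutation of the blocks. -/
  comp_perm : ∀ {n : ℕ} {c : Fin n → Ob} {d : Ob} {j : Fin n → ℕ} {b : ∀ s, Fin (j s) → Ob}
    (f : M.Hom c d) (g : ∀ s, M.Hom (b s) (c s)) (σ : Equiv.Perm (Fin n)),
    mor (M.perm (blockPerm j σ) (M.comp f g)) =
      mor (M.comp (xs := fun s => b (σ s)) (M.perm σ f) (fun s => g (σ s)))
  /-- Equivariance with respect to permutations inside the blocks. -/
  perm_comp : ∀ {n : ℕ} {c : Fin n → Ob} {d : Ob} {j : Fin n → ℕ} {b : ∀ s, Fin (j s) → Ob}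
    (f : M.Hom c d) (g : ∀ s, M.Hom (b s) (c s)) (τ : ∀ s, Equiv.Perm (Fin (j s))),
    mor (M.perm (sumPerm τ) (M.comp f g)) = mor (M.comp f (fun s => M.perm (τ s) (g s)))

end MulticategoryData

/-! ## The categorical operad `Y` -/

/-- Complete parenthesizations of a nonempty list, each of whose slots is filled either with a
variable from `V` or with the identity element. -/
inductive Paren (V : Type w) : Type w
  | unit : Paren V
  | var : V → Paren V
  | mul : Paren V → Paren V → Paren V

namespace Paren

variable {V W : Type w}

/-- The list of the variables that occur, from left to right. -/
def vars : Paren V → List V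
  | unit => []
  | var i => [i]
  | mul s t => s.vars ++ t.vars

/-- Substitution of parenthesized words for the variables. -/
def bind : Paren V → (V → Paren W) → Paren W
  | unit, _ => unit
  | var i, f => f i
  | mul s t, f => mul (s.bind f) (t.bind f)

/-- Renaming of the variables. -/
def rename (f : V → W) (t : Paren V) : Paren W := t.bind fun i => var (f i)

/-- Every variable occurs exactly once. -/
def Linear (t : Paren V) : Prop := t.vars.Nodup ∧ ∀ i, i ∈ t.vars

theorem vars_bind (t : Paren V) (f : V → Paren W) :
    (t.bind f).vars = t.vars.flatMap fun i => (f i).vars := by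
  induction t with
  | unit => rfl
  | var i => simp [bind, vars]
  | mul s t hs ht => simp [bind, vars, hs, ht]

theorem vars_rename (t : Paren V) (f : V → W) : (t.rename f).vars = t.vars.map f := by
  rw [rename, vars_bind]
  induction t.vars with
  | nil => rfl
  | cons a l ih => simp_all [vars]

theorem Linear.rename {t : Paren V} (ht : t.Linear) (e : V ≃ W) : (t.rename e).Linear := by
  refine ⟨?_, fun i => ?_⟩
  · rw [vars_rename]
    exact ht.1.map e.injective
  · rw [vars_rename, List.mem_map]
    exact ⟨e.symm i, ht.2 _, e.apply_symm_apply i⟩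

section Eval

variable {C : Type u} [Category.{v} C] [MonoidalCategory C]

/-- The object obtained by substituting the objects `x i` for the variables, the unit object for
the identity element and the monoidal product for the multiplication. -/
def evalObj : Paren V → (V → C) → C
  | unit, _ => 𝟙_ C
  | var i, x => x i
  | mul s t, x => s.evalObj x ⊗ t.evalObj x

/-- The effect of a parenthesized word on morphisms. -/
def evalMap : (t : Paren V) → {x y : V → C} → (∀ i, x i ⟶ y i) → (t.evalObj x ⟶ t.evalObj y)
  | unit, _, _, _ => 𝟙 (𝟙_ C)
  | var i, _, _, f => f i
  | mul s t, _, _, f => s.evalMap f ⊗ₘ t.evalMap f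

variable (C) in
/-- The functor `C^V ⥤ C` given by a parenthesized word. -/
def functor (t : Paren V) : (V → C) ⥤ C where
  obj x := t.evalObj x
  map f := t.evalMap f
  map_id x := by
    induction t with
    | unit => rfl
    | var i => rfl
    | mul s t hs ht => simp_all [evalMap, evalObj]
  map_comp f g := by
    induction t with
    | unit => exact (Category.comp_id (𝟙 (𝟙_ C))).symm
    | var i => rfl
    | mul s t hs ht =>
      simp only [evalMap, hs, ht]
      exact (tensorHom_comp_tensorHom _ _ _ _).symm

theorem evalObj_bind (t : Paren V) (f : V → Paren W) (x : W → C) :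
    (t.bind f).evalObj x = t.evalObj fun i => (f i).evalObj x := by
  induction t with
  | unit => rfl
  | var i => rfl
  | mul s t hs ht => simp [bind, evalObj, hs, ht]

theorem evalObj_rename (t : Paren V) (f : V → W) (x : W → C) :
    (t.rename f).evalObj x = t.evalObj fun i => x (f i) :=
  evalObj_bind _ _ _

end Eval

end Paren

/-- The category `Y(n)`. An object is a complete parenthesization of a list of length at least `n`,
with the variables `0, …, n - 1` inserted, each exactly once and in any order, in `n` of the slots,
and identity elements in the other slots. -/
def Y (n : ℕ) : Type := {t : Paren (Fin n) // t.Linear}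

namespace Y

/-- There is exactly one morphism from any object of `Y(n)` to any other. -/
instance (n : ℕ) : Category.{0} (Y n) where
  Hom _ _ := Unit
  id _ := ()
  comp _ _ := ()

/-- The unique morphism between two objects of `Y(n)`. -/
def can {n : ℕ} (p q : Y n) : p ⟶ q := ()

/-- The identity element of the operad. -/
def one : Y 1 := ⟨.var 0, by simp [Paren.Linear, Paren.vars, Fin.forall_fin_succ]⟩

/-- The right action of the symmetric group on objects; it is arranged so that
`(p · σ)(σ⁻¹x) = p(x)`. -/
def smul {n : ℕ} (p : Y n) (σ : Equiv.Perm (Fin n)) : Y n :=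
  ⟨p.1.rename σ.symm, p.2.rename σ.symm⟩

/-- The operad composition `γ(p; p₁, …, pₙ)` on objects: the words `p₁, …, pₙ`, with their
variables renumbered consecutively, are substituted for the variables of `p`. -/
def gamma {n : ℕ} (p : Y n) {j : Fin n → ℕ} (ps : ∀ s, Y (j s)) : Y (∑ s, j s) :=
  ⟨p.1.bind fun s => (ps s).1.rename fun t => finSigmaFinEquiv ⟨s, t⟩, by
    refine ⟨?_, fun k => ?_⟩
    · rw [Paren.vars_bind, List.nodup_flatMap]
      refine ⟨fun s _ => ?_, p.2.1.imp fun {s s'} hs => ?_⟩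
      · rw [Paren.vars_rename]
        refine (ps s).2.1.map fun t t' h => ?_
        simpa using h
      · simp only [Function.onFun, Paren.vars_rename, List.disjoint_left, List.mem_map]
        rintro _ ⟨t, _, rfl⟩ ⟨t', _, h⟩
        exact hs (congrArg Sigma.fst (finSigmaFinEquiv.injective h)).symm
    · rw [Paren.vars_bind, List.mem_flatMap]
      refine ⟨(finSigmaFinEquiv.symm k).1, p.2.2 _, ?_⟩
      rw [Paren.vars_rename, List.mem_map]
      exact ⟨(finSigmaFinEquiv.symm k).2, (ps _).2.2 _, finSigmaFinEquiv.apply_symm_apply k⟩⟩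

/-- `(x₀ x₁) x₂` -/
def assocLeft : Y 3 :=
  ⟨.mul (.mul (.var 0) (.var 1)) (.var 2), by simp [Paren.Linear, Paren.vars, Fin.forall_fin_succ]⟩

/-- `x₀ (x₁ x₂)` -/
def assocRight : Y 3 :=
  ⟨.mul (.var 0) (.mul (.var 1) (.var 2)), by simp [Paren.Linear, Paren.vars, Fin.forall_fin_succ]⟩

/-- `1 x₀` -/
def unitLeft : Y 1 := ⟨.mul .unit (.var 0), by simp [Paren.Linear, Paren.vars, Fin.forall_fin_succ]⟩

/-- `x₀ 1` -/
def unitRight : Y 1 := ⟨.mul (.var 0) .unit, by simp [Paren.Linear, Paren.vars, Fin.forall_fin_succ]⟩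

/-- `x₀ x₁`, the generator `m` of the objects in arity two. -/
def mul : Y 2 := ⟨.mul (.var 0) (.var 1), by simp [Paren.Linear, Paren.vars, Fin.forall_fin_succ]⟩

/-- `x₁ x₀` -/
def mulOp : Y 2 := ⟨.mul (.var 1) (.var 0), by simp [Paren.Linear, Paren.vars, Fin.forall_fin_succ]⟩

variable {C : Type u} [Category.{v} C] [MonoidalCategory C]

variable (C) in
/-- The functor `Cⁿ ⥤ C` by which an object of `Y(n)` acts on a monoidal category. -/
abbrev functor {n : ℕ} (p : Y n) : (Fin n → C) ⥤ C := p.1.functor C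

/-- `(p · σ)(σ⁻¹x) = p(x)` -/
theorem smul_obj {n : ℕ} (x : Fin n → C) (p : Y n) (σ : Equiv.Perm (Fin n)) :
    ((p.smul σ).functor C).obj (x ∘ σ) = (p.functor C).obj x := by
  refine (Paren.evalObj_rename p.1 σ.symm (x ∘ σ)).trans (congrArg p.1.evalObj (funext fun i => ?_))
  exact congrArg x (σ.apply_symm_apply i)

/-- `γ(p; p₁, …, pₙ)(⊙ₛ xₛ) = p(p₁(x₁), …, pₙ(xₙ))` -/
theorem gamma_obj {n : ℕ} {j : Fin n → ℕ} (xs : ∀ s, Fin (j s) → C) (p : Y n)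
    (ps : ∀ s, Y (j s)) :
    ((p.gamma ps).functor C).obj (concat xs) =
      (p.functor C).obj fun s => ((ps s).functor C).obj (xs s) := by
  refine (Paren.evalObj_bind _ _ _).trans (congrArg p.1.evalObj (funext fun s => ?_))
  refine (Paren.evalObj_rename _ _ _).trans (congrArg (ps s).1.evalObj (funext fun t => ?_))
  have h : ∀ q : Σ s, Fin (j s), q = ⟨s, t⟩ → xs q.1 q.2 = xs s t := by
    rintro _ rfl
    rfl
  exact h _ (finSigmaFinEquiv.symm_apply_apply _)

end Y

/-- The action of the categorical operad `Y` on a symmetric monoidal category `C`: functors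
`Y(n) ⥤ (Cⁿ ⥤ C)`, given on objects by `Y.functor`, compatible with the symmetric group
actions and with the operad composition, and sending the generating morphisms of `Y` to the
associativity, unit and commutativity isomorphisms of `C`. (The unit law of an action, that
`Y.one` acts as the identity functor of `C`, holds by definition of `Y.functor`.) -/
structure YAction (C : Type u) [Category.{v} C] [MonoidalCategory C] [SymmetricCategory C] where
  /-- The natural transformation by which a morphism of `Y(n)` acts. -/
  map : ∀ {n : ℕ} {p q : Y n}, (p ⟶ q) → (p.functor C ⟶ q.functor C)
  map_id : ∀ {n : ℕ} (p : Y n), map (𝟙 p) = 𝟙 (p.functor C)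
  map_comp : ∀ {n : ℕ} {p q r : Y n} (f : p ⟶ q) (g : q ⟶ r), map (f ≫ g) = map f ≫ map g
  /-- Equivariance: `(f · σ)(σ⁻¹x) = f(x)` for the unique morphism `f : p ⟶ q`. -/
  map_smul : ∀ {n : ℕ} (x : Fin n → C) (p q : Y n) (σ : Equiv.Perm (Fin n)),
    (map (Y.can (p.smul σ) (q.smul σ))).app (x ∘ σ) =
      eqToHom (Y.smul_obj x p σ) ≫ (map (Y.can p q)).app x ≫ eqToHom (Y.smul_obj x q σ).symm
  /-- `γ(f; f₁, …, fₙ)(⊙ₛ xₛ) = f(f₁(x₁), …, fₙ(xₙ))` for the unique morphisms `f : p ⟶ q` and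
  `fₛ : pₛ ⟶ qₛ`. -/
  map_gamma : ∀ {n : ℕ} {j : Fin n → ℕ} (xs : ∀ s, Fin (j s) → C) (p q : Y n)
    (ps qs : ∀ s, Y (j s)),
    (map (Y.can (p.gamma ps) (q.gamma qs))).app (concat xs) =
      eqToHom (Y.gamma_obj xs p ps) ≫
        (p.functor C).map
          (Y := fun s => ((qs s).functor C).obj (xs s))
          (fun s => (map (Y.can (ps s) (qs s))).app (xs s)) ≫
        (map (Y.can p q)).app (fun s => ((qs s).functor C).obj (xs s)) ≫
        eqToHom (Y.gamma_obj xs q qs).symm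
  map_assoc : ∀ x : Fin 3 → C,
    (map (Y.can Y.assocLeft Y.assocRight)).app x = (α_ (x 0) (x 1) (x 2)).hom
  map_leftUnitor : ∀ x : Fin 1 → C, (map (Y.can Y.unitLeft Y.one)).app x = (λ_ (x 0)).hom
  map_rightUnitor : ∀ x : Fin 1 → C, (map (Y.can Y.unitRight Y.one)).app x = (ρ_ (x 0)).hom
  map_braiding : ∀ x : Fin 2 → C,
    (map (Y.can Y.mul Y.mulOp)).app x = (β_ (x 0) (x 1)).hom

namespace YAction

variable {C : Type u} [Category.{v} C] [MonoidalCategory C] [SymmetricCategory C]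

/-- The component at `x` of the action of the unique morphism `p ⟶ q`. -/
def canApp (A : YAction C) {n : ℕ} (p q : Y n) (x : Fin n → C) :
    (p.functor C).obj x ⟶ (q.functor C).obj x :=
  (A.map (Y.can p q)).app x

/-- The underlying multicategory data `U_κ C`. Here `κ̄x = κₙ(x)(x)` and `U_κ C(x; y) = C(κ̄x, y)`.
The identity of `a` is induced by the unique isomorphism `κ₁(a) ⟶ 1`, the map `σ^*` by the
unique isomorphism `κₙ(σ⁻¹x) ⟶ κₙ(x) · σ`, and the composite of `f` and `g₁, …, gₙ` is
`κ̄(⊙ₛ xₛ) ⟶ κₙ(y)(κ̄x₁, …, κ̄xₙ) ⟶ κ̄y ⟶ z`, where the first map is induced by the unique isomorphism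
`κⱼ(⊙ₛ xₛ) ⟶ γ(κₙ(y); κ(x₁), …, κ(xₙ))` and the others are `κₙ(y)(g₁, …, gₙ)` and `f`. -/
def underlying (A : YAction C) (κ : ∀ n : ℕ, (Fin n → C) → Y n) : MulticategoryData.{v} C where
  Hom {n} x y := ((κ n x).functor C).obj x ⟶ y
  one a := A.canApp (κ 1 fun _ => a) Y.one fun _ => a
  perm {n x _} σ f :=
    A.canApp (κ n (x ∘ σ)) ((κ n x).smul σ) (x ∘ σ) ≫ eqToHom (Y.smul_obj x (κ n x) σ) ≫ f
  comp {n y _ j xs} f g :=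
    A.canApp (κ (∑ s, j s) (concat xs)) ((κ n y).gamma fun s => κ (j s) (xs s)) (concat xs) ≫
      eqToHom (Y.gamma_obj xs (κ n y) fun s => κ (j s) (xs s)) ≫
      ((κ n y).functor C).map (Y := y) g ≫ f

end YAction

end SMCMulti

/-! The existence of an action is the coherence theorem for symmetric monoidal categories. A
morphism of `Y n` is made to act by the value of any formal composite (`Coh`) of structure
isomorphisms with the right endpoints. One exists because two linear words have the same variables
up to order (`nonempty_of_perm`), and its value does not depend on the choice (`coherence`). Every
axiom of an action then follows by exhibiting one formal composite with the required value.

Coherence is proved without rewriting theory. The value of a formal isomorphism is natural in the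
tuple `x` and monoidal in it (`tensorMap_eval`), so two parallel formal isomorphisms that agree at
`y` and at `z` agree at every tuple isomorphic to the slotwise product of `y` and `z`. Splitting off
one slot at a time reduces to tuples with at most one non-unit entry. There a word without repeated
variables has a canonical isomorphism to that entry or to the unit, and every formal isomorphism
respects it (`eval_singleIso`, `eval_unitIso`), so its value is forced. Repetitions must be
excluded: the braiding of `x` with itself need not be the identity.

For the multicategory laws the action is arbitrary, and only functoriality, naturality and
compatibility with `σ` and `γ` are used. Each side of a law is brought to the form of one canonical
morphism out of `κ̄x`, followed by functors of words applied to the given morphisms. Canonical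
morphisms at intermediate stages are absorbed into the first (`canApp_gamma_map`,
`canApp_gamma_map_canApp`), so the intermediate choices of `κ` disappear. What is left is an operad
identity between words, up to a cast of arities, and `mor_canApp_congr` concludes. -/

open CategoryTheory MonoidalCategory

namespace SMCMulti

universe v u w

/-! ### Coherence for symmetric monoidal categories. -/

namespace Paren

variable {V W : Type w}

/-- Formal composites of associativity, unit and commutativity isomorphisms between
parenthesized words. -/
inductive Coh : Paren V → Paren V → Type w
  | refl (p : Paren V) : Coh p p
  | symm {p q : Paren V} : Coh p q → Coh q p
  | trans {p q r : Paren V} : Coh p q → Coh q r → Coh p r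
  | tensor {p p' q q' : Paren V} : Coh p p' → Coh q q' → Coh (mul p q) (mul p' q')
  | assoc (p q r : Paren V) : Coh (mul (mul p q) r) (mul p (mul q r))
  | leftUnit (p : Paren V) : Coh (mul unit p) p
  | rightUnit (p : Paren V) : Coh (mul p unit) p
  | braid (p q : Paren V) : Coh (mul p q) (mul q p)

namespace Coh

/-- Each generator only reorders the variables. This invariant carries absence of repetitions and
membership of a variable to the intermediate words in later inductions. -/
theorem vars_perm {p q : Paren V} (f : Coh p q) : p.vars.Perm q.vars := by
  induction f with
  | refl p => exact .refl _
  | symm _ h => exact h.symm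
  | trans _ _ h h' => exact h.trans h'
  | tensor _ _ h h' => exact h.append h'
  | assoc p q r => simp [vars]
  | leftUnit p => simp [vars]
  | rightUnit p => simp [vars]
  | braid p q => exact List.perm_append_comm

/-! ### Formal isomorphisms between words with the same variables -/

/-- The right-bracketed word with a given list of variables. -/
def ofList : List V → Paren V
  | [] => unit
  | a :: l => mul (var a) (ofList l)

/-- The formal isomorphism combining two right-bracketed words into one. -/
def ofListAppend : (l l' : List V) → Coh (mul (ofList l) (ofList l')) (ofList (l ++ l'))
  | [], _ => leftUnit _
  | _ :: l, l' => (assoc _ _ _).trans (tensor (refl _) (ofListAppend l l'))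

/-- The formal isomorphism from a word to its right-bracketed form. -/
def normalize : (p : Paren V) → Coh p (ofList p.vars)
  | unit => refl _
  | var _ => (rightUnit _).symm
  | mul p q => (tensor (normalize p) (normalize q)).trans (ofListAppend _ _)

/-- Permutations of lists are generated by adjacent swaps, and a swap is a braiding conjugated by
associators. -/
theorem nonempty_ofList {l l' : List V} (h : l.Perm l') :
    Nonempty (Coh (ofList l) (ofList l')) := by
  induction h with
  | nil => exact ⟨refl _⟩
  | cons a _ ih => exact ih.map (tensor (refl _))
  | swap a b l =>
    exact ⟨(assoc _ _ _).symm.trans ((tensor (braid _ _) (refl _)).trans (assoc _ _ _))⟩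
  | trans _ _ ih ih' => exact ih.elim fun f => ih'.map f.trans

theorem nonempty_of_perm {p q : Paren V} (h : p.vars.Perm q.vars) : Nonempty (Coh p q) :=
  (nonempty_ofList h).map fun f => (normalize p).trans (f.trans (normalize q).symm)

/-! ### Substitution -/

/-- Substitution of words into a formal isomorphism. -/
def bind {p q : Paren V} (g : V → Paren W) : Coh p q → Coh (p.bind g) (q.bind g)
  | refl _ => refl _
  | symm f => (f.bind g).symm
  | trans f f' => (f.bind g).trans (f'.bind g)
  | tensor f f' => tensor (f.bind g) (f'.bind g)
  | assoc _ _ _ => assoc _ _ _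
  | leftUnit _ => leftUnit _
  | rightUnit _ => rightUnit _
  | braid _ _ => braid _ _

/-- Substitution of formal isomorphisms into a word. -/
def subst {g h : V → Paren W} (φ : ∀ i, Coh (g i) (h i)) : (p : Paren V) → Coh (p.bind g) (p.bind h)
  | unit => refl _
  | var i => φ i
  | mul p q => tensor (subst φ p) (subst φ q)

/-! ### Evaluation -/

section Eval

variable {C : Type u} [Category.{v} C] [MonoidalCategory C] [SymmetricCategory C]

/-- The isomorphism denoted by a formal isomorphism. -/
def eval (x : V → C) : {p q : Paren V} → Coh p q → (p.evalObj x ≅ q.evalObj x)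
  | _, _, refl _ => Iso.refl _
  | _, _, symm f => (eval x f).symm
  | _, _, trans f g => eval x f ≪≫ eval x g
  | _, _, tensor f g => eval x f ⊗ᵢ eval x g
  | _, _, assoc p q r => α_ (p.evalObj x) (q.evalObj x) (r.evalObj x)
  | _, _, leftUnit p => λ_ (p.evalObj x)
  | _, _, rightUnit p => ρ_ (p.evalObj x)
  | _, _, braid p q => β_ (p.evalObj x) (q.evalObj x)

theorem eval_naturality {x y : V → C} (φ : ∀ i, x i ⟶ y i) {p q : Paren V} (f : Coh p q) :
    p.evalMap φ ≫ (eval y f).hom = (eval x f).hom ≫ q.evalMap φ := by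
  induction f with
  | refl p => simp [eval]
  | symm f ih => simp [eval, Iso.comp_inv_eq, ih]
  | trans f g ih ih' => simp [eval, ih', reassoc_of% ih]
  | tensor f g ih ih' =>
    dsimp only [eval, evalMap, evalObj]
    simp only [tensorIso_hom]
    rw [tensorHom_comp_tensorHom, ih, ih', tensorHom_comp_tensorHom]
  | assoc p q r => exact associator_naturality _ _ _
  | leftUnit p =>
    dsimp only [eval, evalMap, evalObj]
    simp
  | rightUnit p =>
    dsimp only [eval, evalMap, evalObj]
    simp
  | braid p q => exact BraidedCategory.braiding_naturality _ _

/-! ### Words with at most one variable whose value is not a unit -/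

/-- A word all of whose variables take unit values evaluates to the unit. -/
def unitIso {x : V → C} {T : V → Prop} (w : ∀ i, T i → (x i ≅ 𝟙_ C)) :
    (p : Paren V) → (∀ i ∈ p.vars, T i) → (p.evalObj x ≅ 𝟙_ C)
  | unit, _ => Iso.refl _
  | var i, h => w i (h i (by simp [vars]))
  | mul p q, h =>
    (unitIso w p (fun i hi => h i (by simp [vars, hi])) ⊗ᵢ
      unitIso w q (fun i hi => h i (by simp [vars, hi]))) ≪≫ λ_ (𝟙_ C)

/-- `unitIso` is built from the word alone, so this equation determines the value of `f`. The case
`braid` rests on the braiding of the unit with itself being trivial. -/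
theorem eval_unitIso {x : V → C} {T : V → Prop} (w : ∀ i, T i → (x i ≅ 𝟙_ C)) {p q : Paren V}
    (f : Coh p q) (hp : ∀ i ∈ p.vars, T i) (hq : ∀ i ∈ q.vars, T i) :
    (eval x f).hom ≫ (unitIso w q hq).hom = (unitIso w p hp).hom := by
  induction f with
  | refl p => simp [eval]
  | symm f ih => simp [eval, Iso.inv_comp_eq, ih hq hp]
  | trans f g ih ih' =>
    have h : ∀ i ∈ _, T i := fun i hi => hp i (f.vars_perm.mem_iff.2 hi)
    simp [eval, ih' h hq, ih hp h]
  | tensor f g ih ih' =>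
    simp only [vars, List.mem_append] at hp hq
    dsimp only [eval, unitIso, evalObj]
    simp only [Iso.trans_hom, tensorIso_hom]
    rw [tensorHom_comp_tensorHom_assoc, ih (fun i hi => hp i (.inl hi)),
      ih' (fun i hi => hp i (.inr hi))]
  | assoc p q r =>
    dsimp only [eval, unitIso, evalObj]
    simp only [Iso.trans_hom, tensorIso_hom]
    monoidal
  | leftUnit p =>
    dsimp only [eval, unitIso, evalObj]
    simp only [Iso.trans_hom, tensorIso_hom]
    simp
  | rightUnit p =>
    dsimp only [eval, unitIso, evalObj]
    simp only [Iso.trans_hom, tensorIso_hom]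
    simp [unitors_equal]
  | braid p q =>
    dsimp only [eval, unitIso, evalObj]
    simp only [Iso.trans_hom, tensorIso_hom]
    rw [← BraidedCategory.braiding_naturality_assoc, braiding_leftUnitor, unitors_equal]

open scoped Classical in
/-- A word in which the variable `a` occurs exactly once and all other variables take unit values
evaluates to the value of `a`. -/
noncomputable def singleIso {x : V → C} {a : V} (w : ∀ i, i ≠ a → (x i ≅ 𝟙_ C)) :
    (p : Paren V) → p.vars.Nodup → a ∈ p.vars → (p.evalObj x ≅ x a)
  | unit, _, h => absurd h (by simp [vars])
  | var i, _, h => eqToIso (congrArg x (List.mem_singleton.1 h).symm)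
  | mul p q, hn, h =>
    if hp : a ∈ p.vars then
      (singleIso w p (List.nodup_append'.1 hn).1 hp ⊗ᵢ
        unitIso w q fun i hi hia => (List.nodup_append'.1 hn).2.2 hp (hia ▸ hi)) ≪≫ ρ_ (x a)
    else
      (unitIso w p (fun i hi hia => hp (hia ▸ hi)) ⊗ᵢ
        singleIso w q (List.nodup_append'.1 hn).2.1 ((List.mem_append.1 h).resolve_left hp)) ≪≫
          λ_ (x a)

/-- Since `a` occurs once, exactly one factor of a product contains it and the other evaluates to
the unit; only braidings with a unit object remain, and these are composites of unitors. -/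
theorem eval_singleIso {x : V → C} {a : V} (w : ∀ i, i ≠ a → (x i ≅ 𝟙_ C)) {p q : Paren V}
    (f : Coh p q) (hp : p.vars.Nodup) (hq : q.vars.Nodup) (hap : a ∈ p.vars) (haq : a ∈ q.vars) :
    (eval x f).hom ≫ (singleIso w q hq haq).hom = (singleIso w p hp hap).hom := by
  induction f with
  | refl p => simp [eval]
  | symm f ih => simp [eval, Iso.inv_comp_eq, ih hq hp haq hap]
  | trans f g ih ih' =>
    have h := f.vars_perm.nodup_iff.1 hp
    have h' := f.vars_perm.mem_iff.1 hap
    simp [eval, ih' h hq h' haq, ih hp h hap h']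
  | @tensor p p' q q' f g ih ih' =>
    have hp' := List.nodup_append'.1 hp
    have hq' := List.nodup_append'.1 hq
    by_cases h : a ∈ p.vars
    · have h' := f.vars_perm.mem_iff.1 h
      simp only [singleIso, h, h', dite_true]
      dsimp only [eval, evalObj]
      simp only [Iso.trans_hom, tensorIso_hom]
      rw [tensorHom_comp_tensorHom_assoc, ih hp'.1 hq'.1 h h', eval_unitIso]
    · have h' := mt f.vars_perm.mem_iff.2 h
      have e : a ∈ q.vars := (List.mem_append.1 hap).resolve_left h
      simp only [singleIso, h, h', dite_false]
      dsimp only [eval, evalObj]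
      simp only [Iso.trans_hom, tensorIso_hom]
      rw [tensorHom_comp_tensorHom_assoc, ih' hp'.2.1 hq'.2.1 e (g.vars_perm.mem_iff.1 e),
        eval_unitIso]
  | assoc p q r =>
    have hp' := List.nodup_append'.1 hp
    have hp'' := List.nodup_append'.1 hp'.1
    have e : (mul p q).vars = p.vars ++ q.vars := rfl
    by_cases h : a ∈ p.vars
    · simp only [singleIso, e, h, dite_true, List.mem_append, true_or]
      dsimp only [eval, unitIso, evalObj]
      simp only [Iso.trans_hom, tensorIso_hom]
      monoidal
    · by_cases h' : a ∈ q.vars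
      · simp only [singleIso, e, h, h', dite_true, dite_false, List.mem_append, false_or]
        dsimp only [eval, unitIso, evalObj]
        simp only [Iso.trans_hom, tensorIso_hom]
        monoidal
      · simp only [singleIso, e, h, h', dite_false, List.mem_append, or_self]
        dsimp only [eval, unitIso, evalObj]
        simp only [Iso.trans_hom, tensorIso_hom]
        monoidal
  | leftUnit p =>
    have h : a ∉ (unit : Paren V).vars := by simp [vars]
    simp only [singleIso, h, dite_false]
    dsimp only [eval, unitIso, evalObj]
    simp only [Iso.trans_hom, tensorIso_hom]
    simp
  | rightUnit p =>
    simp only [singleIso, haq, dite_true]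
    dsimp only [eval, unitIso, evalObj]
    simp only [Iso.trans_hom, tensorIso_hom]
    simp
  | braid p q =>
    by_cases h : a ∈ p.vars
    · have h' : a ∉ q.vars := (List.nodup_append'.1 hp).2.2 h
      simp only [singleIso, h, h', dite_true, dite_false]
      dsimp only [eval, evalObj]
      simp only [Iso.trans_hom, tensorIso_hom]
      rw [← BraidedCategory.braiding_naturality_assoc]
      simp [braiding_tensorUnit_right]
    · have h' : a ∈ q.vars := (List.mem_append.1 hap).resolve_left h
      simp only [singleIso, h, h', dite_true, dite_false]
      dsimp only [eval, evalObj]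
      simp only [Iso.trans_hom, tensorIso_hom]
      rw [← BraidedCategory.braiding_naturality_assoc]
      simp [braiding_tensorUnit_left]

/-! ### Evaluation at a product of tuples -/

/-- The functor given by a word is monoidal. -/
def tensorMap (x y : V → C) : (p : Paren V) →
    (p.evalObj x ⊗ p.evalObj y ⟶ p.evalObj fun i => x i ⊗ y i)
  | unit => (λ_ (𝟙_ C)).hom
  | var _ => 𝟙 _
  | mul p q => tensorμ _ _ _ _ ≫ (tensorMap x y p ⊗ₘ tensorMap x y q)

instance isIso_tensorMap (x y : V → C) (p : Paren V) : IsIso (tensorMap x y p) := by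
  induction p with
  | unit => exact (λ_ (𝟙_ C)).isIso_hom
  | var i => exact IsIso.id (x i ⊗ y i)
  | mul p q hp hq =>
    have : ∀ X₁ X₂ Y₁ Y₂ : C, IsIso (tensorμ X₁ X₂ Y₁ Y₂) :=
      fun _ _ _ _ => ⟨tensorδ _ _ _ _, by simp, by simp⟩
    exact IsIso.comp_isIso' (this _ _ _ _)
      (asIso (tensorMap x y p) ⊗ᵢ asIso (tensorMap x y q)).isIso_hom

/-- Symmetry enters here: the hexagons expand the braiding of the two products into four crossings,
and the one of `Y₁` past `X₂` must cancel the crossing of `X₂` past `Y₁` inside `tensorμ`. -/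
theorem tensorμ_braiding (X₁ X₂ Y₁ Y₂ : C) :
    tensorμ X₁ X₂ Y₁ Y₂ ≫ (β_ (X₁ ⊗ Y₁) (X₂ ⊗ Y₂)).hom =
      ((β_ X₁ X₂).hom ⊗ₘ (β_ Y₁ Y₂).hom) ≫ tensorμ X₂ X₁ Y₂ Y₁ := by
  simp [tensorμ, SymmetricCategory.braiding_swap_eq_inv_braiding Y₁ X₂, MonoidalCategory.tensorHom_def]

/-- The isomorphism denoted by a formal isomorphism is monoidal. -/
theorem tensorMap_eval (x y : V → C) {p q : Paren V} (f : Coh p q) :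
    tensorMap x y p ≫ (eval (fun i => x i ⊗ y i) f).hom =
      ((eval x f).hom ⊗ₘ (eval y f).hom) ≫ tensorMap x y q := by
  induction f with
  | refl p => simp [eval]
  | @symm p q f ih =>
    have h : ((eval x f).hom ⊗ₘ (eval y f).hom) ≫ ((eval x f).inv ⊗ₘ (eval y f).inv) = 𝟙 _ := by
      simp
    simp only [eval, Iso.symm_hom, Iso.comp_inv_eq, Category.assoc, ih]
    simp [tensorHom_comp_tensorHom_assoc]
  | trans f g ih ih' => simp [eval, ih', reassoc_of% ih]
  | tensor f g ih ih' =>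
    dsimp only [eval, tensorMap, evalObj]
    simp only [tensorIso_hom, Category.assoc]
    rw [tensorHom_comp_tensorHom, ih, ih', tensorμ_natural_assoc,
      tensorHom_comp_tensorHom]
  | assoc p q r =>
    dsimp only [eval, tensorMap, evalObj]
    rw [← whiskerRight_comp_tensorHom, ← whiskerLeft_comp_tensorHom, Category.assoc,
      Category.assoc, associator_naturality, associator_monoidal_assoc]
  | leftUnit p =>
    dsimp only [eval, tensorMap, evalObj]
    rw [leftUnitor_monoidal_assoc, MonoidalCategory.tensorHom_def]
    simp
  | rightUnit p =>
    dsimp only [eval, tensorMap, evalObj]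
    rw [rightUnitor_monoidal_assoc, MonoidalCategory.tensorHom_def']
    simp
  | braid p q =>
    dsimp only [eval, tensorMap, evalObj]
    rw [Category.assoc, BraidedCategory.braiding_naturality, reassoc_of% tensorμ_braiding (C := C)]

/-! ### The coherence theorem -/

/-- By naturality the values at `x` and at `y` are conjugate. -/
theorem eval_eq_of_iso {x y : V → C} (e : ∀ i, x i ≅ y i) {p q : Paren V} {f g : Coh p q}
    (h : (eval y f).hom = (eval y g).hom) : (eval x f).hom = (eval x g).hom := by
  have : IsIso (q.evalMap fun i => (e i).hom) :=
    ((q.functor C).mapIso (CategoryTheory.Pi.isoMk e)).isIso_hom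
  rw [← cancel_mono (q.evalMap fun i => (e i).hom), ← eval_naturality, ← eval_naturality, h]

-- Induction on a list `l` containing every slot where `x` is not the unit; each step splits off one
-- slot.
open scoped Classical in
theorem eval_eq_of_support {p q : Paren V} (hp : p.vars.Nodup) (f g : Coh p q) (l : List V) :
    ∀ (x : V → C), (∀ i, i ∉ l → x i = 𝟙_ C) → (eval x f).hom = (eval x g).hom := by
  have hq := f.vars_perm.nodup_iff.1 hp
  induction l with
  | nil =>
    intro x hx
    let w : ∀ i, True → (x i ≅ 𝟙_ C) := fun i _ => eqToIso (hx i (by simp))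
    rw [← cancel_mono (unitIso w q fun _ _ => trivial).hom,
      eval_unitIso w f (fun _ _ => trivial), eval_unitIso w g (fun _ _ => trivial)]
  | cons a l ih =>
    intro x hx
    -- In each slot one of `y i`, `z i` is `x i` and the other is the unit, so a unitor identifies
    -- `x i` with their product; `z` falls under the induction hypothesis.
    let y : V → C := fun i => if i = a then x i else 𝟙_ C
    let z : V → C := fun i => if i = a then 𝟙_ C else x i
    have e : ∀ i, x i ≅ y i ⊗ z i := fun i =>
      if h : i = a then (ρ_ (x i)).symm ≪≫ eqToIso (by simp [y, z, h])
      else (λ_ (x i)).symm ≪≫ eqToIso (by simp [y, z, h])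
    have hz : (eval z f).hom = (eval z g).hom := by
      refine ih z fun i hi => ?_
      by_cases h : i = a
      · simp [z, h]
      · simp [z, h, hx i (by simp [h, hi])]
    have hy : (eval y f).hom = (eval y g).hom := by
      by_cases h : a ∈ p.vars
      · let w : ∀ i, i ≠ a → (y i ≅ 𝟙_ C) := fun i hi => eqToIso (by simp [y, hi])
        have h' := f.vars_perm.mem_iff.1 h
        rw [← cancel_mono (singleIso w q hq h').hom, eval_singleIso w f hp hq h h',
          eval_singleIso w g hp hq h h']
      -- If `a` does not occur, all variables of the words take unit values.
      · let w : ∀ i, i ≠ a → (y i ≅ 𝟙_ C) := fun i hi => eqToIso (by simp [y, hi])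
        have hp : ∀ i ∈ p.vars, i ≠ a := fun i hi hia => h (hia ▸ hi)
        have hq : ∀ i ∈ q.vars, i ≠ a := fun i hi => hp i (f.vars_perm.mem_iff.2 hi)
        rw [← cancel_mono (unitIso w q hq).hom, eval_unitIso w f hp hq, eval_unitIso w g hp hq]
    refine eval_eq_of_iso e ?_
    rw [← cancel_epi (tensorMap y z p), tensorMap_eval, tensorMap_eval, hy, hz]

/-- Coherence: formal isomorphisms between words without repeated variables denote the
same isomorphism if they have the same source and target. -/
theorem coherence [Finite V] (x : V → C) {p q : Paren V} (hp : p.vars.Nodup) (f g : Coh p q) :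
    (eval x f).hom = (eval x g).hom := by
  have := Fintype.ofFinite V
  -- With all variables in the list, the support condition is vacuous.
  exact eval_eq_of_support hp f g Finset.univ.toList x (by simp)

end Eval
end Coh
end Paren

/-! ### Concatenated tuples and equality morphisms. -/

@[simp]
theorem concat_finSigmaFinEquiv {α : Type u} {n : ℕ} {j : Fin n → ℕ} (xs : ∀ s, Fin (j s) → α)
    (s : Fin n) (t : Fin (j s)) : concat xs (finSigmaFinEquiv ⟨s, t⟩) = xs s t := by
  have h : ∀ q : Σ s, Fin (j s), q = ⟨s, t⟩ → xs q.1 q.2 = xs s t := by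
    rintro _ rfl
    rfl
  exact h _ (finSigmaFinEquiv.symm_apply_apply _)

section EqToHom

variable {C : Type u} [Category.{v} C] [MonoidalCategory C]

theorem tensorHom_eqToHom {X X' Y Y' : C} (h : X = X') (h' : Y = Y') :
    eqToHom h ⊗ₘ eqToHom h' = eqToHom (congrArg₂ (· ⊗ ·) h h') := by
  subst h h'
  simp

theorem Paren.evalMap_eqToHom {V : Type w} {x y : V → C} (h : ∀ i, x i = y i) (p : Paren V) :
    p.evalMap (fun i => eqToHom (h i)) = eqToHom (congrArg p.evalObj (funext h)) := by
  obtain rfl : x = y := funext h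
  exact (p.functor C).map_id x

end EqToHom

/-! ### Evaluation of formal isomorphisms after substitution. -/

namespace Paren.Coh

variable {V W : Type w} {C : Type u} [Category.{v} C] [MonoidalCategory C] [SymmetricCategory C]

/-- The two evaluations of a substituted word are equal objects only propositionally. The cases of
the generators are their naturality with respect to equality morphisms. -/
theorem eval_bind (x : W → C) (g : V → Paren W) {p q : Paren V} (f : Coh p q) :
    (eval x (f.bind g)).hom ≫ eqToHom (evalObj_bind q g x) =
      eqToHom (evalObj_bind p g x) ≫ (eval (fun i => (g i).evalObj x) f).hom := by
  induction f with
  | refl p => simp [eval, bind]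
  | symm f ih =>
    simp only [eval, bind, Iso.symm_hom, Iso.inv_comp_eq]
    rw [reassoc_of% ih, Iso.hom_inv_id, Category.comp_id]
  | trans f f' ih ih' => simp [eval, bind, ih', reassoc_of% ih]
  | tensor f f' ih ih' =>
    have h := congrArg₂ (· ⊗ₘ ·) ih ih'
    simp only [← tensorHom_comp_tensorHom, tensorHom_eqToHom] at h
    exact h
  | assoc p q r =>
    have h := associator_naturality (eqToHom (evalObj_bind p g x))
      (eqToHom (evalObj_bind q g x)) (eqToHom (evalObj_bind r g x))
    simp only [tensorHom_eqToHom] at h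
    exact h.symm
  | leftUnit p =>
    have h := leftUnitor_naturality (eqToHom (evalObj_bind p g x))
    rw [← id_tensorHom, ← eqToHom_refl _ rfl, tensorHom_eqToHom] at h
    exact h.symm
  | rightUnit p =>
    have h := rightUnitor_naturality (eqToHom (evalObj_bind p g x))
    rw [← tensorHom_id, ← eqToHom_refl _ rfl, tensorHom_eqToHom] at h
    exact h.symm
  | braid p q =>
    have h := BraidedCategory.braiding_naturality (eqToHom (evalObj_bind p g x))
      (eqToHom (evalObj_bind q g x))
    simp only [tensorHom_eqToHom] at h
    exact h.symm

theorem eval_subst (x : W → C) {g h : V → Paren W} (φ : ∀ i, Coh (g i) (h i)) (p : Paren V) :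
    (eval x (subst φ p)).hom ≫ eqToHom (evalObj_bind p h x) =
      eqToHom (evalObj_bind p g x) ≫ p.evalMap fun i => (eval x (φ i)).hom := by
  induction p with
  | unit => rfl
  | var i => exact (Category.comp_id _).trans (Category.id_comp _).symm
  | mul p q hp hq =>
    have h := congrArg₂ (· ⊗ₘ ·) hp hq
    simp only [← tensorHom_comp_tensorHom, tensorHom_eqToHom] at h
    exact h

/-- For `σ` and `γ` the substituted words take the wanted values only up to propositional equality.
With `y` and both endpoint equalities free, any such identification can be supplied. -/
theorem eval_bind_of_eq {x : W → C} {y : V → C} {g : V → Paren W}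
    (e : ∀ i, (g i).evalObj x = y i) {p q : Paren V} (f : Coh p q)
    (hp : (p.bind g).evalObj x = p.evalObj y) (hq : q.evalObj y = (q.bind g).evalObj x) :
    (eval x (f.bind g)).hom = eqToHom hp ≫ (eval y f).hom ≫ eqToHom hq := by
  obtain rfl : (fun i => (g i).evalObj x) = y := funext e
  rw [← reassoc_of% eval_bind x g f]
  simp

theorem eval_subst_of_eq {x : W → C} {y z : V → C} {g h : V → Paren W}
    {φ : ∀ i, Coh (g i) (h i)} {ψ : ∀ i, y i ⟶ z i} (e : ∀ i, (g i).evalObj x = y i)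
    (e' : ∀ i, z i = (h i).evalObj x)
    (hψ : ∀ i, (eval x (φ i)).hom = eqToHom (e i) ≫ ψ i ≫ eqToHom (e' i)) (p : Paren V)
    (hp : (p.bind g).evalObj x = p.evalObj y) (hq : p.evalObj z = (p.bind h).evalObj x) :
    (eval x (subst φ p)).hom = eqToHom hp ≫ p.evalMap ψ ≫ eqToHom hq := by
  obtain rfl : (fun i => (g i).evalObj x) = y := funext e
  obtain rfl : z = (fun i => (h i).evalObj x) := funext e'
  obtain rfl : (fun i => (eval x (φ i)).hom) = ψ := funext fun i => by simp [hψ i]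
  rw [← reassoc_of% eval_subst x φ p]
  simp

end Paren.Coh

/-! ### The action obtained from coherence. -/

open Paren

/-- A formal isomorphism between two given objects of `Y(n)`. -/
noncomputable def Y.coh {n : ℕ} (p q : Y n) : Coh p.1 q.1 :=
  Classical.choice <| Coh.nonempty_of_perm <|
    (List.perm_ext_iff_of_nodup p.2.1 q.2.1).2 fun i => iff_of_true (p.2.2 i) (q.2.2 i)

/-- The arbitrary choice in `Y.coh` may be replaced by whichever formal isomorphism is convenient.
-/
theorem Y.eval_coh {C : Type u} [Category.{v} C] [MonoidalCategory C] [SymmetricCategory C] {n : ℕ}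
    {p q : Y n} (x : Fin n → C) (f : Coh p.1 q.1) :
    (Coh.eval x (p.coh q)).hom = (Coh.eval x f).hom :=
  Coh.coherence x p.2.1 _ _

/-- The action of `Y` on a symmetric monoidal category given by the coherence theorem. -/
noncomputable def YAction.ofCoherence (C : Type u) [Category.{v} C] [MonoidalCategory C]
    [SymmetricCategory C] : YAction C where
  map {n p q} _ :=
    { app x := (Coh.eval x (p.coh q)).hom
      naturality _ _ φ := Coh.eval_naturality φ _ }
  map_id p := by
    ext x
    exact Y.eval_coh x (.refl p.1)
  map_comp {n p q r} _ _ := by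
    ext x
    exact Y.eval_coh x (.trans (p.coh q) (q.coh r))
  map_smul x p q σ := by
    refine (Y.eval_coh (p := p.smul σ) (q := q.smul σ) _ ((p.coh q).bind _)).trans
      (Coh.eval_bind_of_eq (fun i => ?_) _ _ _)
    exact congrArg x (σ.apply_symm_apply i)
  map_gamma {n j} xs p q ps qs := by
    let g (ps : ∀ s, Y (j s)) (s : Fin n) : Paren (Fin (∑ s, j s)) :=
      (ps s).1.rename fun t => finSigmaFinEquiv ⟨s, t⟩
    have e (ps : ∀ s, Y (j s)) (s : Fin n) :
        (g ps s).evalObj (concat xs) = (ps s).1.evalObj (xs s) := by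
      simp only [g, evalObj_rename, concat_finSigmaFinEquiv]
    let φ (s : Fin n) : Coh (g ps s) (g qs s) := ((ps s).coh (qs s)).bind fun t => .var (finSigmaFinEquiv ⟨s, t⟩)
    -- The convenient formal isomorphism changes the inner words first and then the outer one, in
    -- the order in which `map_gamma` composes.
    refine (Y.eval_coh (p := p.gamma ps) (q := q.gamma qs) _
      ((Coh.subst φ p.1).trans ((p.coh q).bind (g qs)))).trans ?_
    have h := Coh.eval_bind_of_eq (e qs) (p.coh q)
      ((evalObj_bind _ _ _).trans (congrArg _ (funext (e qs)))) (Y.gamma_obj xs q qs).symm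
    have h' := Coh.eval_subst_of_eq (φ := φ) (ψ := fun s => (Coh.eval (xs s) ((ps s).coh (qs s))).hom)
      (e ps) (fun s => (e qs s).symm)
      (fun s => Coh.eval_bind_of_eq (x := concat xs) (y := xs s)
        (g := fun t => .var (finSigmaFinEquiv ⟨s, t⟩)) (fun t => concat_finSigmaFinEquiv xs s t) _ _ _)
      p.1 (Y.gamma_obj xs p ps)
      ((evalObj_bind _ _ _).trans (congrArg _ (funext (e qs)))).symm
    refine (congrArg₂ (· ≫ ·) h' h).trans ?_
    simp only [Category.assoc, eqToHom_trans_assoc, eqToHom_refl, Category.id_comp]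
    rfl
  map_assoc x := Y.eval_coh (p := Y.assocLeft) (q := Y.assocRight) x (.assoc _ _ _)
  map_leftUnitor x := Y.eval_coh (p := Y.unitLeft) (q := Y.one) x (.leftUnit _)
  map_rightUnitor x := Y.eval_coh (p := Y.unitRight) (q := Y.one) x (.rightUnit _)
  map_braiding x := Y.eval_coh (p := Y.mul) (q := Y.mulOp) x (.braid _ _)

/-! ## Positions in a concatenation -/

/-- A position is the total length of the earlier blocks plus the position inside the block. Most of
the later identities between positions are derived from this order instead of from the sums. -/
theorem finSigmaFinEquiv_lt {n : ℕ} {j : Fin n → ℕ} {k l : Σ s, Fin (j s)} :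
    finSigmaFinEquiv k < finSigmaFinEquiv l ↔
      k.1 < l.1 ∨ k.1 = l.1 ∧ (k.2 : ℕ) < l.2 := by
  have off (s : Fin n) : ∑ i : Fin s, j (Fin.castLE s.2.le i) = ∑ i ∈ Finset.Iio s, j i := by
    refine Finset.sum_bij (fun i _ => Fin.castLE s.2.le i) (fun i _ => ?_) (fun i _ i' _ h => ?_)
      (fun i hi => ?_) (fun _ _ => rfl)
    · simp [Fin.lt_def]
    · simpa using h
    · exact ⟨⟨i, by simpa using hi⟩, by simp, rfl⟩
  have main {k l : Σ s, Fin (j s)} (h : k.1 < l.1) :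
      finSigmaFinEquiv k < finSigmaFinEquiv l := by
    rw [Fin.lt_def, finSigmaFinEquiv_apply, finSigmaFinEquiv_apply, off, off]
    have h1 : insert k.1 (Finset.Iio k.1) ⊆ Finset.Iio l.1 := by
      intro i hi
      rcases Finset.mem_insert.1 hi with rfl | hi
      · simpa using h
      · simpa using (Finset.mem_Iio.1 hi).trans h
    have h2 := Finset.sum_le_sum_of_subset (f := j) h1
    rw [Finset.sum_insert (by simp)] at h2
    have := k.2.2
    omega
  rcases lt_trichotomy k.1 l.1 with h | h | h
  · simp [h, main h]
  · have e : ∑ i ∈ Finset.Iio k.1, j i = ∑ i ∈ Finset.Iio l.1, j i := by rw [h]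
    rw [Fin.lt_def, finSigmaFinEquiv_apply, finSigmaFinEquiv_apply, off, off, e]
    simp [h]
  · simp [h.not_gt, h.ne', (main h).not_gt]

/-- Two enumerations inducing the same order agree. -/
theorem cast_eq_of_lt {T : Type*} {n m : ℕ} (e : T ≃ Fin n) (e' : T ≃ Fin m)
    (h : ∀ a b, e a < e b → e' a < e' b) (hn : n = m) (a : T) : Fin.cast hn (e a) = e' a := by
  -- The transition map is a strictly increasing bijection between initial segments of `ℕ`, hence
  -- preserves values.
  have hm : StrictMono (e.symm.trans e') := fun i i' hi => h _ _ (by simpa using hi)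
  have := Fin.coe_orderIso_apply (hm.orderIsoOfSurjective _ (Equiv.surjective _)) (e a)
  ext
  simpa using this.symm

theorem cast_finSigmaFinEquiv_const_one {n : ℕ} (hn : ∑ _ : Fin n, 1 = n) (s : Fin n) (t : Fin 1) :
    Fin.cast hn (finSigmaFinEquiv ⟨s, t⟩) = s :=
  cast_eq_of_lt finSigmaFinEquiv (Equiv.sigmaUnique (Fin n) fun _ => Fin 1)
    (fun a b h => (finSigmaFinEquiv_lt.1 h).resolve_right (by omega)) hn ⟨s, t⟩

theorem cast_finSigmaFinEquiv_of_one {n : ℕ} (hn : ∑ _ : Fin 1, n = n) (s : Fin 1) (t : Fin n) :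
    Fin.cast hn (finSigmaFinEquiv ⟨s, t⟩) = t :=
  Fin.ext (finSigmaFinEquiv_one (n := fun _ => n) ⟨s, t⟩)

theorem sum_sum_eq_sum_finSigmaFinEquiv {n : ℕ} {j : Fin n → ℕ} (l : ∀ s, Fin (j s) → ℕ) :
    ∑ s, ∑ t, l s t =
      ∑ k : Fin (∑ s, j s), l (finSigmaFinEquiv.symm k).1 (finSigmaFinEquiv.symm k).2 := by
  rw [← Fintype.sum_sigma' l]
  exact (Equiv.sum_comp finSigmaFinEquiv.symm fun q : Σ s, Fin (j s) => l q.1 q.2).symm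

theorem finSigmaFinEquiv_finSigmaFinEquiv_lt {n : ℕ} {j : Fin n → ℕ} {l : ∀ s, Fin (j s) → ℕ}
    {q q' : Σ s, Fin (j s)} {u : Fin (l q.1 q.2)} {u' : Fin (l q'.1 q'.2)}
    (h : finSigmaFinEquiv (n := fun s => ∑ t, l s t) ⟨q.1, finSigmaFinEquiv ⟨q.2, u⟩⟩ <
      finSigmaFinEquiv ⟨q'.1, finSigmaFinEquiv ⟨q'.2, u'⟩⟩) :
    finSigmaFinEquiv q < finSigmaFinEquiv q' ∨ q = q' ∧ (u : ℕ) < u' := by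
  obtain ⟨s, t⟩ := q
  obtain ⟨s', t'⟩ := q'
  rw [finSigmaFinEquiv_lt] at h ⊢
  obtain h | ⟨rfl, h⟩ := h
  · exact .inl (.inl h)
  · obtain h | ⟨rfl, h⟩ := finSigmaFinEquiv_lt.1 (Fin.lt_def.2 h)
    · exact .inl (.inr ⟨rfl, h⟩)
    · exact .inr ⟨rfl, h⟩

/-- Iterated concatenation is associative. -/
theorem cast_finSigmaFinEquiv_assoc {n : ℕ} {j : Fin n → ℕ} {l : ∀ s, Fin (j s) → ℕ}
    (hn : ∑ s, ∑ t, l s t =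
      ∑ k : Fin (∑ s, j s), l (finSigmaFinEquiv.symm k).1 (finSigmaFinEquiv.symm k).2)
    (k : Fin (∑ s, j s))
    (u : Fin (l (finSigmaFinEquiv.symm k).1 (finSigmaFinEquiv.symm k).2)) :
    Fin.cast hn (finSigmaFinEquiv ⟨(finSigmaFinEquiv.symm k).1,
      finSigmaFinEquiv ⟨(finSigmaFinEquiv.symm k).2, u⟩⟩) = finSigmaFinEquiv ⟨k, u⟩ := by
  -- This enumeration splits `k` into `(s, t)` and flattens `(s, (t, u))`. Like the direct
  -- flattening of `(k, u)`, it is lexicographic in `s`, `t`, `u`.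
  let e : (Σ k : Fin (∑ s, j s), Fin (l (finSigmaFinEquiv.symm k).1 (finSigmaFinEquiv.symm k).2)) ≃
      Fin (∑ s, ∑ t, l s t) :=
    (((Equiv.sigmaCongrLeft (β := fun q : Σ s, Fin (j s) => Fin (l q.1 q.2))
      finSigmaFinEquiv.symm).trans (Equiv.sigmaAssoc fun s t => Fin (l s t))).trans
      (Equiv.sigmaCongrRight fun s => finSigmaFinEquiv)).trans finSigmaFinEquiv
  refine cast_eq_of_lt e finSigmaFinEquiv ?_ hn ⟨k, u⟩
  rintro ⟨k, u⟩ ⟨k', u'⟩ h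
  refine finSigmaFinEquiv_lt.2 ((finSigmaFinEquiv_finSigmaFinEquiv_lt h).imp (fun h => ?_)
    (And.imp_left fun h => ?_))
  · simpa using h
  · simpa using h

theorem sumPerm_finSigmaFinEquiv {n : ℕ} {j : Fin n → ℕ} (τ : ∀ s, Equiv.Perm (Fin (j s)))
    (s : Fin n) (t : Fin (j s)) :
    sumPerm τ (finSigmaFinEquiv ⟨s, t⟩) = finSigmaFinEquiv ⟨s, τ s t⟩ := by
  simp [sumPerm]

theorem sumPerm_symm_finSigmaFinEquiv {n : ℕ} {j : Fin n → ℕ} (τ : ∀ s, Equiv.Perm (Fin (j s)))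
    (s : Fin n) (t : Fin (j s)) :
    (sumPerm τ).symm (finSigmaFinEquiv ⟨s, t⟩) = finSigmaFinEquiv ⟨s, (τ s).symm t⟩ := by
  simp [Equiv.symm_apply_eq, sumPerm_finSigmaFinEquiv]

theorem blockPerm_cast {n : ℕ} {j : Fin n → ℕ} (σ : Equiv.Perm (Fin n))
    (hn : ∑ s, j (σ s) = ∑ s, j s) (s : Fin n) (t : Fin (j (σ s))) :
    blockPerm j σ (Fin.cast hn (finSigmaFinEquiv ⟨s, t⟩)) = finSigmaFinEquiv ⟨σ s, t⟩ := by
  simp [blockPerm]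

theorem cast_blockPerm_symm {n : ℕ} {j : Fin n → ℕ} (σ : Equiv.Perm (Fin n))
    (hn : ∑ s, j s = ∑ s, j (σ s)) (s : Fin n) (t : Fin (j (σ s))) :
    Fin.cast hn ((blockPerm j σ).symm (finSigmaFinEquiv ⟨σ s, t⟩)) = finSigmaFinEquiv ⟨s, t⟩ := by
  rw [← blockPerm_cast σ hn.symm, Equiv.symm_apply_apply]
  simp

/-! ## Identities between words -/

namespace Paren

variable {U V W : Type w}

/-- Together with `bind_var`, a monad law; the operad identities between words needed below reduce
to these laws and to identities between positions. -/
theorem bind_bind (p : Paren U) (f : U → Paren V) (g : V → Paren W) :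
    (p.bind f).bind g = p.bind fun i => (f i).bind g := by
  induction p with
  | unit => rfl
  | var i => rfl
  | mul p q hp hq => simp [bind, hp, hq]

theorem bind_var (p : Paren V) : p.bind var = p := by
  induction p with
  | unit => rfl
  | var i => rfl
  | mul p q hp hq => simp [bind, hp, hq]

/-! ## Functoriality of substitution -/

variable {C : Type u} [Category.{v} C] [MonoidalCategory C]

theorem evalMap_bind (p : Paren V) (g : V → Paren W) {x y : W → C} (φ : ∀ i, x i ⟶ y i) :
    (p.bind g).evalMap φ ≫ eqToHom (evalObj_bind p g y) =
      eqToHom (evalObj_bind p g x) ≫ p.evalMap fun i => (g i).evalMap φ := by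
  induction p with
  | unit => rfl
  | var i => exact (Category.comp_id _).trans (Category.id_comp _).symm
  | mul p q hp hq =>
    have h := congrArg₂ (· ⊗ₘ ·) hp hq
    simp only [← tensorHom_comp_tensorHom, tensorHom_eqToHom] at h
    exact h

theorem evalMap_bind_of_eq {x x' : W → C} {y z : V → C} {g : V → Paren W}
    {φ : ∀ i, x i ⟶ x' i} {ψ : ∀ i, y i ⟶ z i} (e : ∀ i, (g i).evalObj x = y i)
    (e' : ∀ i, z i = (g i).evalObj x')
    (hψ : ∀ i, (g i).evalMap φ = eqToHom (e i) ≫ ψ i ≫ eqToHom (e' i)) (p : Paren V)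
    (hp : (p.bind g).evalObj x = p.evalObj y) (hq : p.evalObj z = (p.bind g).evalObj x') :
    (p.bind g).evalMap φ = eqToHom hp ≫ p.evalMap ψ ≫ eqToHom hq := by
  obtain rfl : (fun i => (g i).evalObj x) = y := funext e
  obtain rfl : z = (fun i => (g i).evalObj x') := funext e'
  obtain rfl : (fun i => (g i).evalMap φ) = ψ := funext fun i => by simp [hψ i]
  rw [← reassoc_of% evalMap_bind p g φ]
  simp

end Paren

/-! ### The operad structure and the functors of words. -/

namespace Y

variable {C : Type u} [Category.{v} C] [MonoidalCategory C]

theorem smul_map {n : ℕ} {x y : Fin n → C} (φ : ∀ i, x i ⟶ y i) (p : Y n)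
    (σ : Equiv.Perm (Fin n)) :
    ((p.smul σ).functor C).map (X := x ∘ σ) (Y := y ∘ σ) (fun i => φ (σ i)) =
      eqToHom (smul_obj x p σ) ≫ (p.functor C).map φ ≫ eqToHom (smul_obj y p σ).symm := by
  have h (i j : Fin n) (hij : i = j) : φ i =
      eqToHom (congrArg x hij) ≫ φ j ≫ eqToHom (congrArg y hij.symm) := by
    subst hij
    simp
  exact Paren.evalMap_bind_of_eq (x := x ∘ σ) (x' := y ∘ σ) (y := x) (z := y) (ψ := φ)
    (g := fun i => .var (σ.symm i)) (φ := fun i => φ (σ i)) (fun i => congrArg x (σ.apply_symm_apply i))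
    (fun i => congrArg y (σ.apply_symm_apply i).symm)
    (fun i => h _ _ (σ.apply_symm_apply i)) p.1 _ _

/-- The counterpart of `gamma_obj` on morphisms. Associativity needs it: once the outer composite is
normalized, the functor of a word `γ(p; ps)` is applied to the innermost morphisms. -/
theorem gamma_map {n : ℕ} {j : Fin n → ℕ} {xs ys : ∀ s, Fin (j s) → C}
    (φ : ∀ s t, xs s t ⟶ ys s t) (p : Y n) (ps : ∀ s, Y (j s)) :
    ((p.gamma ps).functor C).map (X := concat xs) (Y := concat ys)
        (fun k => φ (finSigmaFinEquiv.symm k).1 (finSigmaFinEquiv.symm k).2) =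
      eqToHom (gamma_obj xs p ps) ≫
        (p.functor C).map (X := fun s => ((ps s).functor C).obj (xs s))
          (Y := fun s => ((ps s).functor C).obj (ys s)) (fun s => ((ps s).functor C).map (φ s)) ≫
        eqToHom (gamma_obj ys p ps).symm := by
  have h (q q' : Σ s, Fin (j s)) (hq : q = q') : φ q.1 q.2 =
      eqToHom (by rw [hq]) ≫ φ q'.1 q'.2 ≫ eqToHom (by rw [hq]) := by
    subst hq
    simp
  have e (xs : ∀ s, Fin (j s) → C) (s : Fin n) :
      ((ps s).1.rename fun t => finSigmaFinEquiv (m := n) ⟨s, t⟩).evalObj (concat xs) =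
        (ps s).1.evalObj (xs s) := by
    simp only [Paren.evalObj_rename, concat_finSigmaFinEquiv]
  refine Paren.evalMap_bind_of_eq (e xs) (fun s => (e ys s).symm) (fun s => ?_) p.1 _ _
  exact Paren.evalMap_bind_of_eq (x := concat xs) (x' := concat ys)
    (y := xs s) (z := ys s) (ψ := φ s)
    (φ := fun k => φ (finSigmaFinEquiv.symm k).1 (finSigmaFinEquiv.symm k).2)
    (g := fun t => .var (finSigmaFinEquiv (m := n) ⟨s, t⟩))
    (fun t => concat_finSigmaFinEquiv xs s t) (fun t => (concat_finSigmaFinEquiv ys s t).symm)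
    (fun t => h _ ⟨s, t⟩ (finSigmaFinEquiv.symm_apply_apply _)) _ _ _

end Y

namespace Y

variable {C : Type u} [Category.{v} C] [MonoidalCategory C]

theorem map_comp {n : ℕ} (p : Y n) {x y z : Fin n → C} (φ : ∀ i, x i ⟶ y i)
    (ψ : ∀ i, y i ⟶ z i) :
    (p.functor C).map (X := x) (Y := z) (fun i => φ i ≫ ψ i) =
      (p.functor C).map (Y := y) φ ≫ (p.functor C).map ψ :=
  (p.functor C).map_comp (X := x) (Y := y) (Z := z) φ ψ

theorem map_eqToHom {n : ℕ} (p : Y n) {x y : Fin n → C} (h : ∀ i, x i = y i) :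
    (p.functor C).map (X := x) (Y := y) (fun i => eqToHom (h i)) =
      eqToHom (congrArg (p.functor C).obj (funext h)) :=
  Paren.evalMap_eqToHom h p.1

theorem map_eqToHom_comp {n : ℕ} (p : Y n) {x y z : Fin n → C} (h : ∀ i, x i = y i)
    (ψ : ∀ i, y i ⟶ z i) :
    (p.functor C).map (X := x) (Y := z) (fun i => eqToHom (h i) ≫ ψ i) =
      eqToHom (congrArg (p.functor C).obj (funext h)) ≫ (p.functor C).map ψ := by
  rw [map_comp, map_eqToHom]

theorem smul_map_eqToHom_assoc {n : ℕ} {x y : Fin n → C} (φ : ∀ i, x i ⟶ y i) (p : Y n)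
    (σ : Equiv.Perm (Fin n)) {z : C} (r : (p.functor C).obj y ⟶ z) :
    ((p.smul σ).functor C).map (X := x ∘ σ) (Y := y ∘ σ) (fun i => φ (σ i)) ≫
        eqToHom (smul_obj y p σ) ≫ r =
      eqToHom (smul_obj x p σ) ≫ (p.functor C).map φ ≫ r := by
  rw [smul_map, Category.assoc, Category.assoc, eqToHom_trans_assoc, eqToHom_refl,
    Category.id_comp]

theorem gamma_map_eqToHom_assoc {n : ℕ} {j : Fin n → ℕ} {xs ys : ∀ s, Fin (j s) → C}
    (φ : ∀ s t, xs s t ⟶ ys s t) (p : Y n) (ps : ∀ s, Y (j s)) {z : C}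
    (r : (p.functor C).obj (fun s => ((ps s).functor C).obj (ys s)) ⟶ z) :
    ((p.gamma ps).functor C).map (X := concat xs) (Y := concat ys)
        (fun k => φ (finSigmaFinEquiv.symm k).1 (finSigmaFinEquiv.symm k).2) ≫
          eqToHom (gamma_obj ys p ps) ≫ r =
      eqToHom (gamma_obj xs p ps) ≫
        (p.functor C).map (X := fun s => ((ps s).functor C).obj (xs s))
          (Y := fun s => ((ps s).functor C).obj (ys s)) (fun s => ((ps s).functor C).map (φ s)) ≫ r := by
  rw [gamma_map, Category.assoc, Category.assoc, eqToHom_trans_assoc, eqToHom_refl,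
    Category.id_comp]

end Y

/-! ### Canonical morphisms of an arbitrary action. -/

namespace YAction

variable {C : Type u} [Category.{v} C] [MonoidalCategory C] [SymmetricCategory C] (A : YAction C)

theorem canApp_trans_assoc {n : ℕ} (p q r : Y n) (x : Fin n → C) {z : C}
    (f : (r.functor C).obj x ⟶ z) :
    A.canApp p q x ≫ A.canApp q r x ≫ f = A.canApp p r x ≫ f := by
  rw [← Category.assoc]
  exact congrArg (fun φ => φ.app x ≫ f) (A.map_comp (Y.can p q) (Y.can q r)).symm

@[simp]
theorem canApp_self {n : ℕ} (p : Y n) (x : Fin n → C) : A.canApp p p x = 𝟙 _ :=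
  congrArg (fun f => f.app x) (A.map_id p)

theorem canApp_naturality {n : ℕ} (p q : Y n) {x y : Fin n → C} (φ : ∀ i, x i ⟶ y i) :
    (p.functor C).map φ ≫ A.canApp p q y = A.canApp p q x ≫ (q.functor C).map φ :=
  (A.map (Y.can p q)).naturality φ

theorem canApp_smul_assoc {n : ℕ} (x : Fin n → C) (p q : Y n) (σ : Equiv.Perm (Fin n)) {z : C}
    (r : (q.functor C).obj x ⟶ z) :
    eqToHom (Y.smul_obj x p σ) ≫ A.canApp p q x ≫ r =
      A.canApp (p.smul σ) (q.smul σ) (x ∘ σ) ≫ eqToHom (Y.smul_obj x q σ) ≫ r := by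
  simp [canApp, A.map_smul]

/-- The action of the isomorphism of composites given by isomorphisms of the inner words. -/
theorem canApp_gamma_inner_assoc {n : ℕ} {j : Fin n → ℕ} (xs : ∀ s, Fin (j s) → C) (p : Y n)
    (ps qs : ∀ s, Y (j s)) {z : C}
    (r : (p.functor C).obj (fun s => ((qs s).functor C).obj (xs s)) ⟶ z) :
    eqToHom (Y.gamma_obj xs p ps) ≫ (p.functor C).map
        (X := fun s => ((ps s).functor C).obj (xs s)) (Y := fun s => ((qs s).functor C).obj (xs s))
        (fun s => A.canApp (ps s) (qs s) (xs s)) ≫ r =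
      A.canApp (p.gamma ps) (p.gamma qs) (concat xs) ≫ eqToHom (Y.gamma_obj xs p qs) ≫ r := by
  have h := A.canApp_self p fun s => ((qs s).functor C).obj (xs s)
  unfold canApp at h ⊢
  simp [A.map_gamma, h]

/-- The action of the isomorphism of composites given by an isomorphism of the outer words. -/
theorem canApp_gamma_outer_assoc {n : ℕ} {j : Fin n → ℕ} (xs : ∀ s, Fin (j s) → C) (p q : Y n)
    (ps : ∀ s, Y (j s)) {z : C}
    (r : (q.functor C).obj (fun s => ((ps s).functor C).obj (xs s)) ⟶ z) :
    eqToHom (Y.gamma_obj xs p ps) ≫ A.canApp p q (fun s => ((ps s).functor C).obj (xs s)) ≫ r =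
      A.canApp (p.gamma ps) (q.gamma ps) (concat xs) ≫ eqToHom (Y.gamma_obj xs q ps) ≫ r := by
  have e : (p.functor C).map (X := fun s => ((ps s).functor C).obj (xs s))
      (Y := fun s => ((ps s).functor C).obj (xs s))
      (fun s => A.canApp (ps s) (ps s) (xs s)) = 𝟙 _ := by
    simp only [canApp_self]
    exact (p.functor C).map_id _
  unfold canApp at e ⊢
  simp [A.map_gamma, e]

/-- Canonical morphisms inside the slots of `p` are absorbed into the leading one. This normalizes
composites whose inner morphisms are themselves composites or permuted. -/
theorem canApp_gamma_map {n : ℕ} {j : Fin n → ℕ} (xs : ∀ s, Fin (j s) → C) {c : Fin n → C} {d : C}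
    (k : Y (∑ s, j s)) (p : Y n) (ps qs : ∀ s, Y (j s))
    (r : ∀ s, ((qs s).functor C).obj (xs s) ⟶ c s) (f : (p.functor C).obj c ⟶ d) :
    A.canApp k (p.gamma ps) (concat xs) ≫ eqToHom (Y.gamma_obj xs p ps) ≫
        (p.functor C).map (X := fun s => ((ps s).functor C).obj (xs s)) (Y := c)
          (fun s => A.canApp (ps s) (qs s) (xs s) ≫ r s) ≫ f =
      A.canApp k (p.gamma qs) (concat xs) ≫ eqToHom (Y.gamma_obj xs p qs) ≫
        (p.functor C).map (X := fun s => ((qs s).functor C).obj (xs s)) (Y := c) r ≫ f := by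
  rw [Y.map_comp, Category.assoc, canApp_gamma_inner_assoc, canApp_trans_assoc]

/-- A canonical morphism after `g` moves in front of it by naturality and is then absorbed. This
normalizes composites whose outer morphism is itself a composite or permuted. -/
theorem canApp_gamma_map_canApp {n : ℕ} {j : Fin n → ℕ} (xs : ∀ s, Fin (j s) → C) {c : Fin n → C}
    {d : C} (k : Y (∑ s, j s)) (p q : Y n) (ps : ∀ s, Y (j s))
    (g : ∀ s, ((ps s).functor C).obj (xs s) ⟶ c s) (f : (q.functor C).obj c ⟶ d) :
    A.canApp k (p.gamma ps) (concat xs) ≫ eqToHom (Y.gamma_obj xs p ps) ≫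
        (p.functor C).map (X := fun s => ((ps s).functor C).obj (xs s)) (Y := c) g ≫
          A.canApp p q c ≫ f =
      A.canApp k (q.gamma ps) (concat xs) ≫ eqToHom (Y.gamma_obj xs q ps) ≫
        (q.functor C).map (X := fun s => ((ps s).functor C).obj (xs s)) (Y := c) g ≫ f := by
  rw [reassoc_of% A.canApp_naturality p q g, canApp_gamma_outer_assoc, canApp_trans_assoc]

/-! ### The multicategory laws. -/

variable (κ : ∀ n : ℕ, (Fin n → C) → Y n)

variable {κ} in
/-- Morphisms `κ̄x ⟶ y` that factor through words which agree up to the identification of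
equal arities represent the same morphism of the underlying multicategory. -/
theorem mor_canApp_congr {n n' : ℕ} (hn : n = n') {x : Fin n → C} {x' : Fin n' → C}
    (hx : ∀ i, x i = x' (Fin.cast hn i)) {p : Y n} {p' : Y n'}
    (hp : p.1.rename (Fin.cast hn) = p'.1) {y : C} {r : (p.functor C).obj x ⟶ y}
    {r' : (p'.functor C).obj x' ⟶ y} (hr : ∀ h, r = eqToHom h ≫ r') :
    MulticategoryData.mor (M := A.underlying κ) (x := x) (A.canApp (κ n x) p x ≫ r) =
      MulticategoryData.mor (M := A.underlying κ) (x := x') (A.canApp (κ n' x') p' x' ≫ r') := by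
  subst hn
  obtain rfl : x = x' := funext hx
  obtain rfl : p = p' := Subtype.ext ((Paren.bind_var p.1).symm.trans hp)
  rw [hr rfl, eqToHom_refl, Category.id_comp]

variable {κ} in
-- Puts a bare morphism into the form to which `mor_canApp_congr` applies.
theorem mor_eq_canApp {n : ℕ} {x : Fin n → C} {y : C} (f : (A.underlying κ).Hom x y) :
    MulticategoryData.mor f =
      MulticategoryData.mor (M := A.underlying κ) (x := x) (A.canApp (κ n x) (κ n x) x ≫ f) := by
  rw [canApp_self]
  exact congrArg _ (Category.id_comp _).symm

theorem underlying_perm_one {n : ℕ} {x : Fin n → C} {y : C} (f : (A.underlying κ).Hom x y) :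
    MulticategoryData.mor ((A.underlying κ).perm 1 f) = MulticategoryData.mor f := by
  refine Eq.trans ?_ (A.mor_eq_canApp f).symm
  refine A.mor_canApp_congr rfl (fun _ => rfl) ?_ fun _ => rfl
  exact (Paren.bind_bind _ _ _).trans (Paren.bind_var _)

theorem underlying_perm_mul {n : ℕ} {x : Fin n → C} {y : C} (σ τ : Equiv.Perm (Fin n))
    (f : (A.underlying κ).Hom x y) :
    MulticategoryData.mor ((A.underlying κ).perm τ ((A.underlying κ).perm σ f)) =
      MulticategoryData.mor ((A.underlying κ).perm (σ * τ) f) := by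
  have e : (A.underlying κ).perm τ ((A.underlying κ).perm σ f) =
      A.canApp (κ n (x ∘ σ ∘ τ)) (((κ n x).smul σ).smul τ) (x ∘ σ ∘ τ) ≫
        eqToHom (Y.smul_obj (x ∘ σ) _ τ) ≫ eqToHom (Y.smul_obj x _ σ) ≫ f := by
    dsimp only [underlying]
    rw [canApp_smul_assoc]
    exact canApp_trans_assoc _ _ _ _ _ _
  rw [e]
  refine A.mor_canApp_congr rfl (fun _ => rfl) ?_ fun _ => ?_
  · simp only [Y.smul, Paren.rename, Paren.bind_bind, Paren.bind]
    rfl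
  · exact (eqToHom_trans_assoc _ _ _).trans (eqToHom_trans_assoc _ _ _).symm

theorem underlying_comp_one {n : ℕ} {c : Fin n → C} {d : C} (f : (A.underlying κ).Hom c d) :
    MulticategoryData.mor ((A.underlying κ).comp f fun s => (A.underlying κ).one (c s)) =
      MulticategoryData.mor f := by
  have e : (A.underlying κ).comp f (fun s => (A.underlying κ).one (c s)) =
      A.canApp (κ _ (concat fun s _ => c s)) ((κ n c).gamma fun _ => Y.one)
        (concat fun s (_ : Fin 1) => c s) ≫
        eqToHom (Y.gamma_obj (fun s (_ : Fin 1) => c s) _ _) ≫ f := by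
    dsimp only [underlying]
    erw [canApp_gamma_inner_assoc]
    exact canApp_trans_assoc _ _ _ _ _ _
  rw [e, A.mor_eq_canApp f]
  have hn : ∑ _ : Fin n, 1 = n := by simp
  refine A.mor_canApp_congr hn (fun i => ?_) ?_ fun _ => rfl
  · obtain ⟨⟨s, t⟩, rfl⟩ := finSigmaFinEquiv.surjective i
    rw [concat_finSigmaFinEquiv, cast_finSigmaFinEquiv_const_one]
  · simp only [Y.gamma, Y.one, Paren.rename, Paren.bind_bind, Paren.bind,
      cast_finSigmaFinEquiv_const_one, Paren.bind_var]

theorem underlying_one_comp {n : ℕ} {c : Fin n → C} {d : C} (f : (A.underlying κ).Hom c d) :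
    MulticategoryData.mor
        ((A.underlying κ).comp (xs := fun _ => c) ((A.underlying κ).one d) fun _ => f) =
      MulticategoryData.mor f := by
  have e : (A.underlying κ).comp (xs := fun _ => c) ((A.underlying κ).one d) (fun _ => f) =
      A.canApp (κ _ (concat fun _ => c)) (Y.one.gamma fun _ => κ n c)
        (concat fun _ => c) ≫ eqToHom (Y.gamma_obj (fun _ => c) _ _) ≫ f := by
    dsimp only [underlying]
    erw [canApp_naturality, canApp_gamma_outer_assoc]
    exact canApp_trans_assoc _ _ _ _ _ _
  rw [e, A.mor_eq_canApp f]
  have hn : ∑ _ : Fin 1, n = n := by simp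
  refine A.mor_canApp_congr hn (fun i => ?_) ?_ fun _ => rfl
  · obtain ⟨⟨s, t⟩, rfl⟩ := finSigmaFinEquiv.surjective i
    rw [concat_finSigmaFinEquiv, cast_finSigmaFinEquiv_of_one]
  · simp only [Y.gamma, Y.one, Paren.rename, Paren.bind_bind, Paren.bind,
      cast_finSigmaFinEquiv_of_one, Paren.bind_var]

theorem underlying_perm_comp {n : ℕ} {c : Fin n → C} {d : C} {j : Fin n → ℕ}
    {b : ∀ s, Fin (j s) → C} (f : (A.underlying κ).Hom c d)
    (g : ∀ s, (A.underlying κ).Hom (b s) (c s)) (τ : ∀ s, Equiv.Perm (Fin (j s))) :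
    MulticategoryData.mor ((A.underlying κ).perm (sumPerm τ) ((A.underlying κ).comp f g)) =
      MulticategoryData.mor
        ((A.underlying κ).comp f fun s => (A.underlying κ).perm (τ s) (g s)) := by
  have e : (A.underlying κ).perm (sumPerm τ) ((A.underlying κ).comp f g) =
      A.canApp (κ _ (concat b ∘ sumPerm τ))
        (((κ n c).gamma fun s => κ _ (b s)).smul (sumPerm τ)) (concat b ∘ sumPerm τ) ≫
        eqToHom (Y.smul_obj (concat b) _ (sumPerm τ)) ≫
        eqToHom (Y.gamma_obj b (κ n c) fun s => κ _ (b s)) ≫ ((κ n c).functor C).map g ≫ f := by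
    dsimp only [underlying]
    rw [canApp_smul_assoc]
    exact canApp_trans_assoc _ _ _ _ _ _
  have e' : (A.underlying κ).comp f (fun s => (A.underlying κ).perm (τ s) (g s)) =
      A.canApp (κ _ (concat fun s => b s ∘ τ s))
        ((κ n c).gamma fun s => (κ _ (b s)).smul (τ s)) (concat fun s => b s ∘ τ s) ≫
        eqToHom (Y.gamma_obj (fun s => b s ∘ τ s) (κ n c) _) ≫
        eqToHom (congrArg ((κ n c).functor C).obj (funext fun s => Y.smul_obj (b s) _ (τ s))) ≫
        ((κ n c).functor C).map g ≫ f := by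
    have h := A.canApp_gamma_map (fun s => b s ∘ τ s) (κ _ (concat fun s => b s ∘ τ s)) (κ n c)
      (fun s => κ _ (b s ∘ τ s)) (fun s => (κ _ (b s)).smul (τ s))
      (fun s => eqToHom (Y.smul_obj (b s) _ (τ s)) ≫ g s) f
    refine h.trans ?_
    erw [Y.map_eqToHom_comp, Category.assoc]
  rw [e, e']
  refine A.mor_canApp_congr rfl (fun i => ?_) ?_ fun _ => ?_
  · obtain ⟨⟨s, t⟩, rfl⟩ := finSigmaFinEquiv.surjective i
    simp [sumPerm_finSigmaFinEquiv]
  -- Both words replace variable `t` of block `s` by the variable at position `(s, (τ s).symm t)`.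
  · simp only [Y.gamma, Y.smul, Paren.rename, Paren.bind_bind, Paren.bind,
      sumPerm_symm_finSigmaFinEquiv]
    rfl
  · simp only [eqToHom_trans_assoc]

theorem underlying_comp_perm {n : ℕ} {c : Fin n → C} {d : C} {j : Fin n → ℕ}
    {b : ∀ s, Fin (j s) → C} (f : (A.underlying κ).Hom c d)
    (g : ∀ s, (A.underlying κ).Hom (b s) (c s)) (σ : Equiv.Perm (Fin n)) :
    MulticategoryData.mor ((A.underlying κ).perm (blockPerm j σ) ((A.underlying κ).comp f g)) =
      MulticategoryData.mor ((A.underlying κ).comp (xs := fun s => b (σ s))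
        ((A.underlying κ).perm σ f) fun s => g (σ s)) := by
  have e : (A.underlying κ).perm (blockPerm j σ) ((A.underlying κ).comp f g) =
      A.canApp (κ _ (concat b ∘ blockPerm j σ))
        (((κ n c).gamma fun s => κ _ (b s)).smul (blockPerm j σ)) (concat b ∘ blockPerm j σ) ≫
        eqToHom (Y.smul_obj (concat b) _ (blockPerm j σ)) ≫
        eqToHom (Y.gamma_obj b (κ n c) fun s => κ _ (b s)) ≫ ((κ n c).functor C).map g ≫ f := by
    dsimp only [underlying]
    rw [canApp_smul_assoc]
    exact canApp_trans_assoc _ _ _ _ _ _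
  have e' : (A.underlying κ).comp (xs := fun s => b (σ s)) ((A.underlying κ).perm σ f)
        (fun s => g (σ s)) =
      A.canApp (κ _ (concat fun s => b (σ s)))
        (((κ n c).smul σ).gamma fun s => κ _ (b (σ s))) (concat fun s => b (σ s)) ≫
        eqToHom (Y.gamma_obj (fun s => b (σ s)) _ _) ≫
        eqToHom (Y.smul_obj (fun s => ((κ _ (b s)).functor C).obj (b s)) (κ n c) σ) ≫
        ((κ n c).functor C).map g ≫ f := by
    refine (A.canApp_gamma_map_canApp (fun s => b (σ s)) _ _ _ _ (fun s => g (σ s)) _).trans ?_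
    erw [Y.smul_map_eqToHom_assoc]
  rw [e, e']
  have hn : ∑ s, j s = ∑ s, j (σ s) := (Equiv.sum_comp σ j).symm
  refine A.mor_canApp_congr hn (fun i => ?_) ?_ fun _ => ?_
  · obtain ⟨i, rfl⟩ := (finCongr hn).symm.surjective i
    obtain ⟨⟨s, t⟩, rfl⟩ := finSigmaFinEquiv.surjective i
    simp [blockPerm_cast]
  · simp only [Y.gamma, Y.smul, Paren.rename, Paren.bind_bind, Paren.bind]
    refine congrArg (Paren.bind _) (funext fun s => ?_)
    -- The inverse block permutation is known on blocks indexed by `σ s`.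
    obtain ⟨s, rfl⟩ := σ.surjective s
    simp only [cast_blockPerm_symm]
    rw [σ.symm_apply_apply]
  · simp only [eqToHom_trans_assoc]

theorem underlying_assoc {n : ℕ} {c : Fin n → C} {d : C} {j : Fin n → ℕ}
    {b : ∀ s, Fin (j s) → C} {l : ∀ s, Fin (j s) → ℕ} {a : ∀ s t, Fin (l s t) → C}
    (f : (A.underlying κ).Hom c d) (g : ∀ s, (A.underlying κ).Hom (b s) (c s))
    (h : ∀ s t, (A.underlying κ).Hom (a s t) (b s t)) :
    MulticategoryData.mor
        ((A.underlying κ).comp f fun s => (A.underlying κ).comp (g s) (h s)) =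
      MulticategoryData.mor ((A.underlying κ).comp (y := concat b)
        (xs := fun k => a (finSigmaFinEquiv.symm k).1 (finSigmaFinEquiv.symm k).2)
        ((A.underlying κ).comp f g)
        fun k => h (finSigmaFinEquiv.symm k).1 (finSigmaFinEquiv.symm k).2) := by
  have e : (A.underlying κ).comp f (fun s => (A.underlying κ).comp (g s) (h s)) =
      A.canApp (κ _ (concat fun s => concat (a s)))
        ((κ n c).gamma fun s => (κ _ (b s)).gamma fun t => κ _ (a s t))
        (concat fun s => concat (a s)) ≫
        eqToHom (Y.gamma_obj (fun s => concat (a s)) _ _) ≫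
        eqToHom (congrArg ((κ n c).functor C).obj (funext fun s =>
          Y.gamma_obj (a s) (κ _ (b s)) fun t => κ _ (a s t))) ≫
        ((κ n c).functor C).map
          (X := fun s => ((κ _ (b s)).functor C).obj fun t => ((κ _ (a s t)).functor C).obj (a s t))
          (Y := fun s => ((κ _ (b s)).functor C).obj (b s))
          (fun s => ((κ _ (b s)).functor C).map (h s)) ≫
        ((κ n c).functor C).map g ≫ f := by
    have h := A.canApp_gamma_map (fun s => concat (a s)) (κ _ (concat fun s => concat (a s)))
      (κ n c) (fun s => κ _ (concat (a s))) (fun s => (κ _ (b s)).gamma fun t => κ _ (a s t))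
      (fun s => eqToHom (Y.gamma_obj (a s) (κ _ (b s)) fun t => κ _ (a s t)) ≫
        ((κ _ (b s)).functor C).map (h s) ≫ g s) f
    refine h.trans ?_
    erw [Y.map_eqToHom_comp, Y.map_comp, Category.assoc, Category.assoc]
  have e' : (A.underlying κ).comp (y := concat b)
        (xs := fun k => a (finSigmaFinEquiv.symm k).1 (finSigmaFinEquiv.symm k).2)
        ((A.underlying κ).comp f g)
        (fun k => h (finSigmaFinEquiv.symm k).1 (finSigmaFinEquiv.symm k).2) =
      A.canApp _ (((κ n c).gamma fun s => κ _ (b s)).gamma fun k =>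
          κ _ (a (finSigmaFinEquiv.symm k).1 (finSigmaFinEquiv.symm k).2)) _ ≫
        eqToHom (Y.gamma_obj _ _ _) ≫
        eqToHom (Y.gamma_obj (fun s t => ((κ _ (a s t)).functor C).obj (a s t)) (κ n c) fun s =>
          κ _ (b s)) ≫
        ((κ n c).functor C).map
          (X := fun s => ((κ _ (b s)).functor C).obj fun t => ((κ _ (a s t)).functor C).obj (a s t))
          (Y := fun s => ((κ _ (b s)).functor C).obj (b s))
          (fun s => ((κ _ (b s)).functor C).map (h s)) ≫
        ((κ n c).functor C).map g ≫ f := by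
    refine (A.canApp_gamma_map_canApp
      (fun k => a (finSigmaFinEquiv.symm k).1 (finSigmaFinEquiv.symm k).2) _ _ _ _
      (fun k => h (finSigmaFinEquiv.symm k).1 (finSigmaFinEquiv.symm k).2) _).trans ?_
    erw [Y.gamma_map_eqToHom_assoc h]
    rfl
  rw [e, e']
  refine A.mor_canApp_congr (sum_sum_eq_sum_finSigmaFinEquiv l) (fun i => ?_) ?_ fun _ => ?_
  · obtain ⟨i, rfl⟩ := (finCongr (sum_sum_eq_sum_finSigmaFinEquiv l)).symm.surjective i
    obtain ⟨⟨k, u⟩, rfl⟩ := finSigmaFinEquiv.surjective i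
    rw [finCongr_symm, finCongr_apply, Fin.cast_cast, Fin.cast_eq_self, concat_finSigmaFinEquiv,
      ← cast_finSigmaFinEquiv_assoc (sum_sum_eq_sum_finSigmaFinEquiv l), Fin.cast_cast,
      Fin.cast_eq_self, concat_finSigmaFinEquiv, concat_finSigmaFinEquiv]
  · simp only [Y.gamma, Paren.rename, Paren.bind_bind, Paren.bind]
    refine congrArg (Paren.bind _) (funext fun s => congrArg (Paren.bind _) (funext fun t => ?_))
    -- The type of `u` depends on the pair of indices, so the pair is generalized to `q` and the
    -- equality eliminated, in place of rewriting.
    have (k : Fin (∑ s, j s)) (q : Σ s, Fin (j s)) (hq : finSigmaFinEquiv.symm k = q) :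
        ((κ _ (a q.1 q.2)).1.bind fun u => Paren.var (Fin.cast (sum_sum_eq_sum_finSigmaFinEquiv l)
          (finSigmaFinEquiv ⟨q.1, finSigmaFinEquiv ⟨q.2, u⟩⟩))) =
        (κ _ (a (finSigmaFinEquiv.symm k).1 (finSigmaFinEquiv.symm k).2)).1.bind fun u =>
          Paren.var (finSigmaFinEquiv ⟨k, u⟩) := by
      subst hq
      simp only [cast_finSigmaFinEquiv_assoc]
    exact this _ ⟨s, t⟩ (finSigmaFinEquiv.symm_apply_apply _)
  · exact (eqToHom_trans_assoc _ _ _).trans ((eqToHom_trans_assoc _ _ _).trans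
      (eqToHom_trans_assoc _ _ _)).symm

end YAction

end SMCMulti

theorem theorem2p2 {C : Type*} [Category C] [MonoidalCategory C] [SymmetricCategory C] :
    Nonempty (SMCMulti.YAction C) ∧
      ∀ (A : SMCMulti.YAction C) (κ : ∀ n : ℕ, (Fin n → C) → SMCMulti.Y n),
        (A.underlying κ).IsSymmMulticategory :=
  ⟨⟨.ofCoherence C⟩, fun A κ =>
    { perm_one := A.underlying_perm_one κ
      perm_mul := A.underlying_perm_mul κ
      assoc := A.underlying_assoc κ
      comp_one := A.underlying_comp_one κ
      one_comp := A.underlying_one_comp κ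
      comp_perm := A.underlying_comp_perm κ
      perm_comp := A.underlying_perm_comp κ }⟩
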